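/- **Setting.** A rack is a set with two binary operations $\rhd,\rhd^{-1}$ such that $(x\rhd y)\rhd^{-1}y=(x\rhd^{-1}y)\rhd y=x$ and $(x\rhd y)\rhd z=(x\rhd z)\rhd(y\rhd z)$. Let $S=\{x_1,\dots,x_g\}$ be a finite set, $F(S)$ the free group on $S$, and write $\bar w=w^{-1}$. The free rack $FR(S)$ is the set of symbols $a^w$ ($a\in S$, $w\in F(S)$; $a^u=b^v$ iff $a=b$ and $u=v$) with $a^u\rhd b^v=a^{u\bar v b v}$ and $a^u\rhd^{-1}b^v=a^{u\bar v\bar b v}$; $a\in S$ is identified with $a^1$. Let $R$ be a finite set of relations $x_i^u=x_j$ with $u\in F(S)$ (written as a reduced word), none of which is of the form $x_i=x_j$ with $u$ empty and $i\ne j$. The rack $\mathcal R=\langle S\mid R\rangle$ is the quotient of $FR(S)$ by the smallest congruence (equivalence relation compatible with both operations) containing $R$. For $x\in\mathcal R$ and $s\in S$ put $x^{s}=x\rhd s$, $x^{\bar s}=x\rhd^{-1}s$. **Tables.** An enumeration table $\mathcal E=(\omega,A,\tau,\rho)$ has rows $1,\dots,\omega$, a partial function $A$ from pairs (row, letter $y\in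 S\cup\bar S$) to rows, written $i^y=A(i,y)$, a map $\tau$ from rows to $\mathcal R$, and a map $\rho$ from rows to rows with $\rho(i)\le i$. The set of live rows is $\Omega=\{i:\rho(i)=i\}$ (with $\max\emptyset=0$). The table is complete if $i^y$ is defined for all $i\in\Omega$ and $y\in S\cup\bar S$. $\mathrm{Rep}(i)$ is obtained by iterating $\rho$ from $i$ until it stops decreasing. **Subroutines.** - $\mathrm{Define}(i,y)$: $\omega:=\omega+1$; $i^y:=\omega$; $\omega^{\bar y}:=i$; $\tau(\omega):=\tau(i)^y$; $\rho(\omega):=\omega$. - $\mathrm{Update}(i)$: set $\rho(n):=\mathrm{Rep}(i)$ for all $n$ on the $\rho$-path from $i$ with $\rho(n)<n$. - $\mathrm{Merge}(m,n)$, with a queue $Q$: let $\mu=\mathrm{Rep}(m)$, $\nu=\mathrm{Rep}(n)$; if $\mu\neq\nu$, append $\max(\mu,\nu)$ to $Q$ and set $\rho(\max(\mu,\nu)):=\min(\mu,\nu)$. - $\mathrm{Coincidence}(m,n)$: start with $Q$ empty and call $\mathrm{Merge}(m,n)$. While $Q$ has an unprocessed element, take the first one, $d$, and for each $x\in S\cup\bar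 S$ such that $d^x$ is defined, say $d^x=e$: undefine $d^x$ and $e^{\bar x}$; set $\delta:=\mathrm{Rep}(d)$; $\mathrm{Update}(d)$; $\epsilon:=\mathrm{Rep}(e)$; $\mathrm{Update}(e)$; if $\delta^x$ is defined, call $\mathrm{Merge}(\epsilon,\delta^x)$; else if $\epsilon^{\bar x}$ is defined, call $\mathrm{Merge}(\delta,\epsilon^{\bar x})$; else set $\delta^x:=\epsilon$ and $\epsilon^{\bar x}:=\delta$. - $\mathrm{Scan}(i,w,j)$ for a reduced word $w=y_1\cdots y_t$: put $f:=1$, $b:=t$, $k:=i$, $\ell:=j$. While $f\le b$: as long as $f\le b$ and $k^{y_f}$ is defined, set $k:=k^{y_f}$, $f:=f+1$; then as long as $f\le b$ and $\ell^{\bar y_b}$ is defined, set $\ell:=\ell^{\bar y_b}$, $b:=b-1$; then, if $f<b$, call $\mathrm{Define}(k,y_f)$; if $f=b$, set $k^{y_f}:=\ell$ and $\ell^{\bar y_f}:=k$ and stop; if $f>b$, call $\mathrm{Coincidence}(k,\ell)$ in case $k\ne\ell$, and stop. **The procedure** $\mathrm{Enumerate}(S,R,M)$, with run limit $M\in\mathbb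 N$. Let $R_2$ be the set of reduced words of $\bar u x_i u\bar x_j$ for the relations $x_i^u=x_j$ in $R$. Start with $\omega=g$, no $i^y$ defined, $\tau(i)=x_i$, $\rho(i)=i$. For each relation $x_i^u=x_j$ in $R$ call $\mathrm{Scan}(\mathrm{Rep}(i),u,\mathrm{Rep}(j))$. Then put $i:=1$ and, while $i\le\max\Omega$ and $i\le M$: for each $w\in R_2$ call $\mathrm{Scan}(i,w,i)$ if $i\in\Omega$, and leave this loop if $i\notin\Omega$; then, if $i\in\Omega$, call $\mathrm{Define}(i,y)$ for each $y\in S\cup\bar S$ with $i^y$ undefined; then $i:=i+1$. At the end, if $i>\max\Omega$, return $\mathcal E$; otherwise return "run limit exceeded". The loops over $R$, $R_2$ and $S\cup\bar S$ run through these finite sets in arbitrary fixed orders. The procedure *completes* if it returns a complete table. **Claim.** For all $S$, $R$ as above, and for every choice of the orders of the loops, the rack $\langle S\mid R\rangle$ is finite if and only if there is an $M$ such that $\mathrm{Enumerate}(S,R,M)$ completes. -/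

import Mathlib

namespace RackEnum

/-! ### Free racks and presented racks

Mathlib's racks act on the left. The right operations of a rack are recovered by
`x ▷ y = Shelf.act y x` and `x ▷⁻¹ y = Rack.invAct y x`. -/

/-- The free rack on `S`: the element `a^w` is the pair of `a : S` and `w` in the free group. -/
structure FreeRack (S : Type*) where
  base : S
  exponent : FreeGroup S

/-- `a^u ▷ b^v = a^(u v⁻¹ b v)` and `a^u ▷⁻¹ b^v = a^(u v⁻¹ b⁻¹ v)`. -/
instance (S : Type*) : Rack (FreeRack S) where
  act y x := ⟨x.base, x.exponent * y.exponent⁻¹ * FreeGroup.of y.base * y.exponent⟩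
  self_distrib := by
    intro x y z
    simp only [FreeRack.mk.injEq, true_and]
    group
  invAct y x := ⟨x.base, x.exponent * y.exponent⁻¹ * (FreeGroup.of y.base)⁻¹ * y.exponent⟩
  left_inv := by
    intro y x
    cases x
    simp only [FreeRack.mk.injEq, true_and]
    group
  right_inv := by
    intro y x
    cases x
    simp only [FreeRack.mk.injEq, true_and]
    group

/-- The relation `x_i ^ u = x_j` between elements of the free rack on `x_1, …, x_g`.
The element `s : Fin g` stands for the generator `x_(s+1)`. -/
structure Relation (g : ℕ) where
  i : Fin g
  u : FreeGroup (Fin g)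
  j : Fin g

/-- The smallest rack congruence on the free rack that contains the relations in `R`. -/
inductive Congruent {g : ℕ} (R : Finset (Relation g)) :
    FreeRack (Fin g) → FreeRack (Fin g) → Prop
  | rel (r : Relation g) : r ∈ R → Congruent R ⟨r.i, r.u⟩ ⟨r.j, 1⟩
  | refl (x : FreeRack (Fin g)) : Congruent R x x
  | symm {x y : FreeRack (Fin g)} : Congruent R x y → Congruent R y x
  | trans {x y z : FreeRack (Fin g)} : Congruent R x y → Congruent R y z → Congruent R x z
  | act {x x' y y' : FreeRack (Fin g)} : Congruent R x x' → Congruent R y y' →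
      Congruent R (Shelf.act y x) (Shelf.act y' x')
  | invAct {x x' y y' : FreeRack (Fin g)} : Congruent R x x' → Congruent R y y' →
      Congruent R (Rack.invAct y x) (Rack.invAct y' x')

/-- The congruence as a setoid. -/
def congruence {g : ℕ} (R : Finset (Relation g)) : Setoid (FreeRack (Fin g)) where
  r := Congruent R
  iseqv := ⟨Congruent.refl, Congruent.symm, Congruent.trans⟩

/-- The rack `⟨x_1, …, x_g | R⟩`. -/
def PresentedRack {g : ℕ} (R : Finset (Relation g)) : Type :=
  Quotient (congruence R)

/-- The operations of the presented rack are induced by those of the free rack. -/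
instance {g : ℕ} (R : Finset (Relation g)) : Rack (PresentedRack R) where
  act := Quotient.map₂ (fun y x => Shelf.act y x) (fun _ _ hy _ _ hx => Congruent.act hx hy)
  self_distrib := by
    rintro ⟨x⟩ ⟨y⟩ ⟨z⟩
    exact congrArg (Quotient.mk (congruence R)) Shelf.self_distrib
  invAct := Quotient.map₂ (fun y x => Rack.invAct y x)
    (fun _ _ hy _ _ hx => Congruent.invAct hx hy)
  left_inv := by
    rintro ⟨y⟩ ⟨x⟩
    exact congrArg (Quotient.mk (congruence R)) (Rack.left_inv y x)
  right_inv := by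
    rintro ⟨y⟩ ⟨x⟩
    exact congrArg (Quotient.mk (congruence R)) (Rack.right_inv y x)

/-- The generator `x_(s+1)` of the presented rack. -/
def generator {g : ℕ} (R : Finset (Relation g)) (s : Fin g) : PresentedRack R :=
  Quotient.mk (congruence R) ⟨s, 1⟩

/-! ### Letters, secondary relations, enumeration tables -/

/-- The set `S ∪ S̄`: `(s, true)` is the generator `s`, and `(s, false)` is its inverse. Words in
these letters, and their reduction, are those of Mathlib's `FreeGroup (Fin g)`. -/
abbrev Letter (g : ℕ) : Type := Fin g × Bool

/-- The letter `ȳ`. -/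
def Letter.bar {g : ℕ} (y : Letter g) : Letter g := (y.1, !y.2)

/-- The element `x^y` of the presented rack, for a letter `y`. -/
def letterAct {g : ℕ} {R : Finset (Relation g)} (x : PresentedRack R) (y : Letter g) :
    PresentedRack R :=
  if y.2 then Shelf.act (generator R y.1) x else Rack.invAct (generator R y.1) x

/-- The set `R₂` of the elements `ū x_i u x̄_j`, for `x_i ^ u = x_j` in `R`. An element of the free
group stands for its reduced word. -/
def secondaryRelations {g : ℕ} (R : Finset (Relation g)) : Finset (FreeGroup (Fin g)) :=
  R.image fun r => r.u⁻¹ * FreeGroup.of r.i * r.u * (FreeGroup.of r.j)⁻¹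

/-- The state `(ω, A, τ, ρ)` of an enumeration table. The rows are `1, …, ω`; the values at other
indices are never used. The partial function `A` takes `(i, y)` to `i^y`, if that is defined. -/
structure Table {g : ℕ} (R : Finset (Relation g)) where
  ω : ℕ
  A : ℕ → Letter g → Option ℕ
  τ : ℕ → Option (PresentedRack R)
  ρ : ℕ → ℕ

namespace Table

variable {g : ℕ} {R : Finset (Relation g)}

/-- The set `Ω` of live elements. -/
def live (T : Table R) : Finset ℕ := {i ∈ Finset.Icc 1 T.ω | T.ρ i = i}

/-- `max Ω`, with value `0` if there is no live element (which requires `g = 0`). -/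
def maxLive (T : Table R) : ℕ := T.live.sup id

/-- A table is complete if `i^y` is defined for every live `i` and every letter `y`. -/
def IsComplete (T : Table R) : Prop :=
  ∀ i ∈ T.live, ∀ y : Letter g, (T.A i y).isSome

/-- The assignment `i^y := v`, where `v = none` means that `i^y` becomes undefined. -/
def setEntry (T : Table R) (i : ℕ) (y : Letter g) (v : Option ℕ) : Table R :=
  { T with A := Function.update T.A i (Function.update (T.A i) y v) }

end Table

/-! ### The subroutines -/

/-- The initial table: row `i` represents `x_i` for `1 ≤ i ≤ g`, and no `i^y` is defined. -/
def init {g : ℕ} (R : Finset (Relation g)) : Table R where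
  ω := g
  A := fun _ _ => none
  τ := fun i => if h : i - 1 < g ∧ 1 ≤ i then some (generator R ⟨i - 1, h.1⟩) else none
  ρ := id

/-- DEFINE: add a new row for `i^y`. -/
def define {g : ℕ} {R : Finset (Relation g)} (T : Table R) (i : ℕ) (y : Letter g) : Table R :=
  let n := T.ω + 1
  let T₁ := (T.setEntry i y (some n)).setEntry n y.bar (some i)
  { T₁ with
    ω := n
    τ := Function.update T.τ n ((T.τ i).map fun x => letterAct x y)
    ρ := Function.update T.ρ n n }

/-- DEDUCTION: `i^y := j` and `j^ȳ := i`. -/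
def deduction {g : ℕ} {R : Finset (Relation g)} (T : Table R) (i : ℕ) (y : Letter g) (j : ℕ) :
    Table R :=
  (T.setEntry i y (some j)).setEntry j y.bar (some i)

/-- REP: follow `ρ` from `j` as long as it decreases. -/
def rep (ρ : ℕ → ℕ) (j : ℕ) : ℕ :=
  if _h : ρ j < j then rep ρ (ρ j) else j
termination_by j

/-- The loop of UPDATE: set `ρ` to `ε` along the decreasing `ρ`-path from `n`. -/
def updateLoop (ε : ℕ) (ρ : ℕ → ℕ) (n : ℕ) : ℕ → ℕ :=
  if _h : ρ n < n then updateLoop ε (Function.update ρ n ε) (ρ n) else ρ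
termination_by n

/-- UPDATE. -/
def update (ρ : ℕ → ℕ) (i : ℕ) : ℕ → ℕ := updateLoop (rep ρ i) ρ i

/-- MERGE: add the coincidence `m ≡ n` to the queue `Q` and kill the larger representative. -/
def merge {g : ℕ} {R : Finset (Relation g)} (s : Table R × List ℕ) (m n : ℕ) :
    Table R × List ℕ :=
  let T := s.1
  let Q := s.2
  let μ := rep T.ρ m
  let ν := rep T.ρ n
  if μ ≠ ν then
    ({ T with ρ := Function.update T.ρ (max μ ν) (min μ ν) }, Q ++ [max μ ν])
  else (T, Q)

/-- The body of the loop over the letters `x` in COINCIDENCE, for the dead element `d`. -/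
def coincidenceStep {g : ℕ} {R : Finset (Relation g)} (d : ℕ) (s : Table R × List ℕ)
    (x : Letter g) : Table R × List ℕ :=
  match s.1.A d x with
  | none => s
  | some e =>
    let T₁ := (s.1.setEntry d x none).setEntry e x.bar none
    let δ := rep T₁.ρ d
    let T₂ := { T₁ with ρ := update T₁.ρ d }
    let ε := rep T₂.ρ e
    let T₃ := { T₂ with ρ := update T₂.ρ e }
    match T₃.A δ x with
    | some f => merge (T₃, s.2) ε f
    | none =>
      match T₃.A ε x.bar with
      | some f => merge (T₃, s.2) δ f
      | none => ((T₃.setEntry δ x (some ε)).setEntry ε x.bar (some δ), s.2)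

/-- The loop of COINCIDENCE. The list is the part of the queue that has not been processed.
A `while` loop is written with Mathlib's `PFun.fix`, which repeats the step as long as it returns a
new state `Sum.inr s`, and stops with the result `x` when it returns `Sum.inl x`; the value in
`Part` is undefined if that never happens. -/
def coincidenceLoop {g : ℕ} {R : Finset (Relation g)} (letters : List (Letter g)) :
    Table R × List ℕ →. Table R :=
  PFun.fix fun s =>
    match s with
    | (T, []) => Part.some (Sum.inl T)
    | (T, d :: Q) => Part.some (Sum.inr (letters.foldl (coincidenceStep d) (T, Q)))

/-- COINCIDENCE: resolve the coincidence `m ≡ n`. -/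
def coincidence {g : ℕ} {R : Finset (Relation g)} (letters : List (Letter g))
    (T : Table R) (m n : ℕ) : Part (Table R) :=
  coincidenceLoop letters (merge (T, []) m n)

/-- Scan forward from `k` along the word `v` as far as possible: the result is the row that is
reached and the part of `v` that remains. -/
def scanForward {g : ℕ} (A : ℕ → Letter g → Option ℕ) (k : ℕ) (v : List (Letter g)) :
    ℕ × List (Letter g) :=
  match v with
  | [] => (k, [])
  | y :: v' =>
    match A k y with
    | some k' => scanForward A k' v'
    | none => (k, y :: v')

/-- Scan backward from `l` along the word `v` as far as possible, that is, forward along `v̄`. -/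
def scanBackward {g : ℕ} (A : ℕ → Letter g → Option ℕ) (l : ℕ) (v : List (Letter g)) :
    ℕ × List (Letter g) :=
  let p := scanForward A l (FreeGroup.invRev v)
  (p.1, FreeGroup.invRev p.2)

/-- One round of the loop of SCAN. In a state `(T, k, v, l)`, the word `v = y_f … y_b` is the part
between the forward scan, which has reached row `k`, and the backward scan, which has reached row
`l`. So `v` is empty, has one letter, or has more letters if and only if `b < f`, `f = b`, or
`f < b`, respectively. -/
def scanStep {g : ℕ} {R : Finset (Relation g)} (letters : List (Letter g)) :
    Table R × ℕ × List (Letter g) × ℕ →. Table R ⊕ (Table R × ℕ × List (Letter g) × ℕ) :=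
  fun s =>
    match s with
    | (T, _, [], _) => Part.some (Sum.inl T)
    | (T, k, v, l) =>
      let p := scanForward T.A k v
      let q := scanBackward T.A l p.2
      match q.2 with
      | [] =>
        if p.1 ≠ q.1 then (coincidence letters T p.1 q.1).map Sum.inl
        else Part.some (Sum.inl T)
      | [y] => Part.some (Sum.inl (deduction T p.1 y q.1))
      | y :: y' :: v' => Part.some (Sum.inr (define T p.1 y, p.1, y :: y' :: v', q.1))

/-- SCAN of the relation `i^w = j`. -/
def scan {g : ℕ} {R : Finset (Relation g)} (letters : List (Letter g))
    (T : Table R) (i : ℕ) (w : List (Letter g)) (j : ℕ) : Part (Table R) :=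
  PFun.fix (scanStep letters) (T, i, w, j)

/-! ### The enumeration process -/

/-- The orders in which the loops of the process run through the finite sets `S ∪ S̄` of letters,
`R` of primary relations, and `R₂` of secondary relations. -/
structure LoopOrder {g : ℕ} (R : Finset (Relation g)) where
  letters : List (Letter g)
  letters_nodup : letters.Nodup
  mem_letters : ∀ y, y ∈ letters
  primary : List (Relation g)
  primary_nodup : primary.Nodup
  mem_primary : ∀ r, r ∈ primary ↔ r ∈ R
  secondary : List (FreeGroup (Fin g))
  secondary_nodup : secondary.Nodup
  mem_secondary : ∀ w, w ∈ secondary ↔ w ∈ secondaryRelations R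

instance {g : ℕ} (R : Finset (Relation g)) : Nonempty (LoopOrder R) :=
  ⟨{ letters := (Finset.univ : Finset (Letter g)).toList
     letters_nodup := Finset.nodup_toList _
     mem_letters := fun y => Finset.mem_toList.2 (Finset.mem_univ y)
     primary := R.toList
     primary_nodup := Finset.nodup_toList _
     mem_primary := fun _ => Finset.mem_toList
     secondary := (secondaryRelations R).toList
     secondary_nodup := Finset.nodup_toList _
     mem_secondary := fun _ => Finset.mem_toList }⟩

variable {g : ℕ} {R : Finset (Relation g)}

/-- Scan the primary relations: SCAN(REP(i), u, REP(j)) for each relation `x_i ^ u = x_j`. -/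
def scanPrimary (o : LoopOrder R) (T : Table R) : Part (Table R) :=
  o.primary.foldlM (fun T r =>
    scan o.letters T (rep T.ρ (r.i + 1)) r.u.toWord (rep T.ρ (r.j + 1))) T

/-- Scan the secondary relations in the list for row `i`, and stop as soon as `i` is dead. -/
def scanSecondary (letters : List (Letter g)) (i : ℕ) :
    List (FreeGroup (Fin g)) → Table R → Part (Table R)
  | [], T => Part.some T
  | w :: ws, T =>
    if i ∈ T.live then do
      let T' ← scan letters T i w.toWord i
      scanSecondary letters i ws T'
    else Part.some T

/-- If `i` is live, define all those `i^y` that are undefined. -/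
def fillRow (letters : List (Letter g)) (i : ℕ) (T : Table R) : Table R :=
  if i ∈ T.live then
    letters.foldl (fun T y => if T.A i y = none then define T i y else T) T
  else T

/-- The main loop, up to the point where `i > max Ω` or `i > M`. It returns the last `i` too. -/
def mainLoop (o : LoopOrder R) (M i : ℕ) (T : Table R) : Part (ℕ × Table R) :=
  if _h : i ≤ T.maxLive ∧ i ≤ M then do
    let T' ← scanSecondary o.letters i o.secondary T
    mainLoop o M (i + 1) (fillRow o.letters i T')
  else Part.some (i, T)
termination_by M + 1 - i

/-- What ENUMERATE returns: a table, or the message "run limit exceeded". -/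
inductive Outcome (R : Finset (Relation g)) where
  | table (T : Table R)
  | runLimitExceeded

/-- ENUMERATE with run limit `M`. The value is undefined if some loop runs forever. -/
def enumerate (o : LoopOrder R) (M : ℕ) : Part (Outcome R) := do
  let T ← scanPrimary o (init R)
  let (i, T') ← mainLoop o M 1 T
  if T'.maxLive < i then return Outcome.table T' else return Outcome.runLimitExceeded

/-- ENUMERATE completes if it returns a complete table. -/
def Completes (o : LoopOrder R) (M : ℕ) : Prop :=
  ∃ T : Table R, Outcome.table T ∈ enumerate o M ∧ T.IsComplete

end RackEnum

namespace RackEnum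

variable {g : ℕ} {R : Finset (Relation g)}

/-! ### Letters and words acting on the presented rack -/

/-! The proof rests on two notions. `Valid` is the invariant of a table: its labels in the rack are
compatible with entries and coincidences. `Extends` is the order in which tables grow: information
is lost only by identifying rows. Since entries move when rows die, edges are compared between
classes of rows with a common representative (`ClassEdge`, `ClassPath`). Every subroutine terminates
on a valid table and yields a valid extension. For COINCIDENCE the measure is the number of live
rows plus the length of the queue; for SCAN it is, in essence, the length of the unread word.

If the process completes, the labels of the live rows contain the generators and are closed under
all letters, so they exhaust the rack (`finite_of_isComplete`).

Conversely, let the rack be finite and suppose that the run without a limit never stops. The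
representative of a fixed row can only decrease, so it settles at a row that never dies
(`IsRun.exists_limitRep`). Each immortal row is filled in its own round and its entries settle too,
so the immortal rows carry a right action of the free group. The primary relations hold at the
limits of the first `g` rows, the secondary ones at every point. Hence sending `a^w` to the image
under `w` of the limit row of `a` is well defined on the presented rack (`Congruent.map_eq`). This
map is onto, because every later row is reached by an edge from an earlier one. So there are
finitely many immortal rows. At a late time all their entries are final, and tracing edges from the
generators shows that every live row is immortal. Then `max Ω` is bounded, although it has to exceed
the number of rounds: a contradiction (`IsRun.exists_maxLive_lt`). The first time at which no row is
left to process serves as the run limit (`IsRun.completes`). -/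

theorem Letter.bar_bar (y : Letter g) : y.bar.bar = y := by
  simp [Letter.bar]

theorem Letter.bar_ne (y : Letter g) : y.bar ≠ y := by
  intro h
  have := congrArg Prod.snd h
  simp [Letter.bar] at this

/-- The action of a word on the presented rack, letter by letter. -/
def wordAct (x : PresentedRack R) (w : List (Letter g)) : PresentedRack R :=
  w.foldl letterAct x

theorem letterAct_mk (a : Fin g) (u : FreeGroup (Fin g)) (y : Letter g) :
    letterAct (Quotient.mk (congruence R) ⟨a, u⟩ : PresentedRack R) y =
      Quotient.mk (congruence R) ⟨a, u * FreeGroup.mk [y]⟩ := by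
  obtain ⟨s, b⟩ := y
  cases b
  · refine congrArg (Quotient.mk (congruence R)) ?_
    change FreeRack.mk a (u * 1⁻¹ * (FreeGroup.of s)⁻¹ * 1) = _
    have h : (FreeGroup.of s)⁻¹ = FreeGroup.mk [(s, false)] := rfl
    rw [h]; simp
  · refine congrArg (Quotient.mk (congruence R)) ?_
    change FreeRack.mk a (u * 1⁻¹ * (FreeGroup.of s) * 1) = _
    have h : (FreeGroup.of s) = FreeGroup.mk [(s, true)] := rfl
    rw [h]; simp

theorem wordAct_mk (a : Fin g) (u : FreeGroup (Fin g)) (w : List (Letter g)) :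
    wordAct (Quotient.mk (congruence R) ⟨a, u⟩ : PresentedRack R) w =
      Quotient.mk (congruence R) ⟨a, u * FreeGroup.mk w⟩ := by
  induction w generalizing u with
  | nil => rw [← FreeGroup.one_eq_mk, mul_one]; rfl
  | cons y w ih =>
    have : wordAct (Quotient.mk (congruence R) ⟨a, u⟩ : PresentedRack R) (y :: w) =
      wordAct (letterAct (Quotient.mk (congruence R) ⟨a, u⟩ : PresentedRack R) y) w := rfl
    rw [this, letterAct_mk, ih, mul_assoc, FreeGroup.mul_mk]
    rfl

theorem wordAct_append (x : PresentedRack R) (v w : List (Letter g)) :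
    wordAct x (v ++ w) = wordAct (wordAct x v) w :=
  List.foldl_append

theorem wordAct_append_invRev (x : PresentedRack R) (v w : List (Letter g)) :
    wordAct (wordAct x (v ++ w)) (FreeGroup.invRev w) = wordAct x v := by
  obtain ⟨a, u⟩ := x
  change wordAct (wordAct (Quotient.mk (congruence R) ⟨a, u⟩) _) _ =
    wordAct (Quotient.mk (congruence R) ⟨a, u⟩) _
  rw [wordAct_mk, wordAct_mk, wordAct_mk, ← FreeGroup.inv_mk, ← FreeGroup.mul_mk]
  congr 2
  group

theorem letterAct_bar (x : PresentedRack R) (y : Letter g) :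
    letterAct (letterAct x y) y.bar = x :=
  wordAct_append_invRev x [] [y]

theorem wordAct_relation {r : Relation g} (hr : r ∈ R) :
    wordAct (generator R r.i) r.u.toWord = generator R r.j := by
  rw [generator, wordAct_mk, FreeGroup.mk_toWord, one_mul]
  exact Quotient.sound (Congruent.rel r hr)

/-- The word `ū x_i u x̄_j` acts by `x ↦ (x ▷ x_i^u) ▷⁻¹ x_j`, and the congruent elements `x_i^u`
and `x_j` act in the same way. This is why secondary relations are scanned at every row, not only at
generators. -/
theorem wordAct_secondary {w : FreeGroup (Fin g)} (hw : w ∈ secondaryRelations R)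
    (x : PresentedRack R) : wordAct x w.toWord = x := by
  obtain ⟨a, v⟩ := x
  obtain ⟨r, hr, rfl⟩ := Finset.mem_image.1 hw
  change wordAct (Quotient.mk (congruence R) ⟨a, v⟩) _ = Quotient.mk (congruence R) ⟨a, v⟩
  rw [wordAct_mk, FreeGroup.mk_toWord]
  refine Quotient.sound ?_
  have h := Congruent.invAct (Congruent.act (Congruent.refl ⟨a, v⟩) (Congruent.rel r hr))
    (Congruent.refl (R := R) ⟨r.j, 1⟩)
  rw [Rack.left_inv] at h
  have e : (⟨a, v * (r.u⁻¹ * FreeGroup.of r.i * r.u * (FreeGroup.of r.j)⁻¹)⟩ : FreeRack (Fin g)) =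
      Rack.invAct ⟨r.j, 1⟩ (Shelf.act ⟨r.i, r.u⟩ ⟨a, v⟩) := by
    change _ = FreeRack.mk a (v * r.u⁻¹ * FreeGroup.of r.i * r.u * 1⁻¹ *
      (FreeGroup.of r.j)⁻¹ * 1)
    congr 1
    group
  rw [e]
  exact h

/-! ### Representatives -/

section Rep

variable {ρ : ℕ → ℕ}

theorem rep_of_lt {j : ℕ} (h : ρ j < j) : rep ρ j = rep ρ (ρ j) := by
  rw [rep, dif_pos h]

theorem rep_of_eq {j : ℕ} (h : ρ j = j) : rep ρ j = j := by
  rw [rep, dif_neg (by omega)]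

theorem rep_le (ρ : ℕ → ℕ) (j : ℕ) : rep ρ j ≤ j := by
  induction j using Nat.strong_induction_on with
  | _ j ih =>
    by_cases h : ρ j < j
    · rw [rep_of_lt h]; exact (ih _ h).trans h.le
    · rw [rep, dif_neg h]

theorem rep_lt {j : ℕ} (h : ρ j < j) : rep ρ j < j := by
  rw [rep_of_lt h]; exact (rep_le ρ _).trans_lt h

theorem map_rep (hρ : ∀ j, ρ j ≤ j) (j : ℕ) : ρ (rep ρ j) = rep ρ j := by
  induction j using Nat.strong_induction_on with
  | _ j ih =>
    by_cases h : ρ j < j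
    · rw [rep_of_lt h]; exact ih _ h
    · rw [rep, dif_neg h]; have := hρ j; omega

theorem rep_rep (hρ : ∀ j, ρ j ≤ j) (j : ℕ) : rep ρ (rep ρ j) = rep ρ j :=
  rep_of_eq (map_rep hρ j)

theorem rep_map (hρ : ∀ j, ρ j ≤ j) (j : ℕ) : rep ρ (ρ j) = rep ρ j := by
  rcases (hρ j).lt_or_eq with h | h
  · rw [rep_of_lt h]
  · rw [h]

theorem rep_eq_self_iff (hρ : ∀ j, ρ j ≤ j) {j : ℕ} : rep ρ j = j ↔ ρ j = j :=
  ⟨fun h => by rw [← h]; exact map_rep hρ j, rep_of_eq⟩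

theorem rep_pos (hρ : ∀ j, 1 ≤ j → 1 ≤ ρ j) {j : ℕ} (hj : 1 ≤ j) : 1 ≤ rep ρ j := by
  induction j using Nat.strong_induction_on with
  | _ j ih =>
    by_cases h : ρ j < j
    · rw [rep_of_lt h]; exact ih _ h (hρ j hj)
    · rwa [rep, dif_neg h]

/-- Path compression is harmless: a shortened pointer still leads to the same root. The hypothesis
on `ρ'` is the form in which UPDATE is controlled below. -/
theorem rep_congr {ρ' : ℕ → ℕ} (hρ : ∀ j, ρ j ≤ j) (h : ∀ j, ρ' j = ρ j ∨ ρ' j = rep ρ j) :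
    rep ρ' = rep ρ := by
  funext j
  induction j using Nat.strong_induction_on with
  | _ j ih =>
    rcases (hρ j).lt_or_eq with hj | hj
    · rcases h j with h | h
      · rw [rep_of_lt (h ▸ hj), h, ih _ hj, rep_of_lt hj]
      · have h' := rep_lt hj
        rw [rep_of_lt (h ▸ h'), h, ih _ h', rep_rep hρ]
    · have : ρ' j = j := by
        rcases h j with h | h
        · rw [h, hj]
        · rw [h, rep_of_eq hj]
      rw [rep_of_eq this, rep_of_eq hj]

/-- Here `ρ₀` is the map before the loop and `ρ` a partially compressed one. Both possible values of
`ρ n` have the same `ρ₀`-representative as `n`, so the target fixed at the start stays correct along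
the path. -/
theorem updateLoop_spec {ρ₀ : ℕ → ℕ} (hρ : ∀ j, ρ₀ j ≤ j) (n : ℕ) :
    ∀ ρ : ℕ → ℕ, (∀ j, ρ j = ρ₀ j ∨ ρ j = rep ρ₀ j) → ∀ j,
      updateLoop (rep ρ₀ n) ρ n j = ρ₀ j ∨ updateLoop (rep ρ₀ n) ρ n j = rep ρ₀ j := by
  induction n using Nat.strong_induction_on with
  | _ n ih =>
    intro ρ h
    rw [updateLoop]
    split_ifs with hn
    · have hr : rep ρ₀ n = rep ρ₀ (ρ n) := by
        rcases h n with h | h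
        · rw [h, rep_map hρ]
        · rw [h, rep_rep hρ]
      have := ih _ hn (Function.update ρ n (rep ρ₀ n)) (fun j => by
        by_cases hj : j = n
        · subst hj; simp
        · simpa [hj] using h j)
      rwa [← hr] at this
    · exact h

theorem update_spec (hρ : ∀ j, ρ j ≤ j) (i j : ℕ) :
    update ρ i j = ρ j ∨ update ρ i j = rep ρ j :=
  updateLoop_spec hρ i ρ (fun _ => Or.inl rfl) j

theorem rep_update_root (hρ : ∀ j, ρ j ≤ j) {a b : ℕ} (hab : a < b) (ha : ρ a = a)
    (hb : ρ b = b) (j : ℕ) :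
    rep (Function.update ρ b a) j = if rep ρ j = b then a else rep ρ j := by
  have hra : rep (Function.update ρ b a) a = a := by
    apply rep_of_eq; rw [Function.update_of_ne hab.ne, ha]
  induction j using Nat.strong_induction_on with
  | _ j ih =>
    by_cases hj : j = b
    · subst hj
      rw [rep_of_lt (by simpa using hab), Function.update_self, hra]
      rw [if_pos (rep_of_eq hb)]
    · rcases (hρ j).lt_or_eq with h | h
      · rw [rep_of_lt (by simpa [hj] using h), Function.update_of_ne hj, ih _ h, rep_of_lt h]
      · rw [rep_of_eq h, if_neg hj, rep_of_eq (by simpa [hj] using h)]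

end Rep

/-! ### Class edges, the order on tables, and the invariant -/

theorem Table.mem_live {T : Table R} {i : ℕ} : i ∈ T.live ↔ (1 ≤ i ∧ i ≤ T.ω) ∧ T.ρ i = i := by
  simp [Table.live]

/-- There is an edge with label `y` from the class of `a` to the class of `b`, where rows are in
the same class if they have the same representative. -/
def ClassEdge (T : Table R) (a : ℕ) (y : Letter g) (b : ℕ) : Prop :=
  ∃ i j, T.A i y = some j ∧ rep T.ρ i = rep T.ρ a ∧ rep T.ρ j = rep T.ρ b

/-- There is a path of class edges with label `w` from the class of `a` to the class of `b`. -/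
def ClassPath (T : Table R) (a : ℕ) : List (Letter g) → ℕ → Prop
  | [], b => rep T.ρ a = rep T.ρ b
  | y :: w, b => ∃ c, ClassEdge T a y c ∧ ClassPath T c w b

/-- The table `T'` extends `T`: all information in `T` persists up to coincidences, and every new
row is reached by an edge from an earlier row. -/
structure Extends (T T' : Table R) : Prop where
  ω_le : T.ω ≤ T'.ω
  rep_rep : ∀ i, rep T'.ρ (rep T.ρ i) = rep T'.ρ i
  edge : ∀ {i y j}, T.A i y = some j → ClassEdge T' i y j
  reach : ∀ j, T.ω < j → j ≤ T'.ω → ∃ i y, i < j ∧ ClassEdge T' i y j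
  τ_eq : ∀ i ≤ T.ω, T'.τ i = T.τ i

/-- The invariant of the process, where `Q` contains all dead rows that still have entries. -/
structure Valid (T : Table R) (Q : List ℕ) : Prop where
  ρ_le : ∀ j, T.ρ j ≤ j
  ρ_pos : ∀ j, 1 ≤ j → 1 ≤ T.ρ j
  ρ_of_gt : ∀ j, T.ω < j → T.ρ j = j
  τ_ρ : ∀ j, T.τ (T.ρ j) = T.τ j
  symm : ∀ {i y j}, T.A i y = some j → T.A j y.bar = some i
  row : ∀ {i y j}, T.A i y = some j → 1 ≤ i ∧ i ≤ T.ω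
  τ_A : ∀ {i y j}, T.A i y = some j → T.τ j = (T.τ i).map fun t => letterAct t y
  dead : ∀ {i y j}, T.A i y = some j → T.ρ i = i ∨ i ∈ Q
  queue : ∀ d ∈ Q, T.ρ d < d

section

variable {T T' T'' : Table R} {Q : List ℕ}

theorem ClassEdge.of_entry {i j : ℕ} {y : Letter g} (h : T.A i y = some j) : ClassEdge T i y j :=
  ⟨i, j, h, rfl, rfl⟩

theorem ClassEdge.congr {a a' b b' : ℕ} {y : Letter g} (h : ClassEdge T a y b)
    (ha : rep T.ρ a = rep T.ρ a') (hb : rep T.ρ b = rep T.ρ b') : ClassEdge T a' y b' := by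
  obtain ⟨i, j, h, hi, hj⟩ := h
  exact ⟨i, j, h, hi.trans ha, hj.trans hb⟩

theorem ClassEdge.symm (hT : Valid T Q) {a b : ℕ} {y : Letter g} (h : ClassEdge T a y b) :
    ClassEdge T b y.bar a := by
  obtain ⟨i, j, h, hi, hj⟩ := h
  exact ⟨j, i, hT.symm h, hj, hi⟩

theorem Extends.rep_eq (h : Extends T T') {a b : ℕ} (hab : rep T.ρ a = rep T.ρ b) :
    rep T'.ρ a = rep T'.ρ b := by
  rw [← h.rep_rep a, hab, h.rep_rep]

theorem Extends.classEdge (h : Extends T T') {a b : ℕ} {y : Letter g} (hab : ClassEdge T a y b) :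
    ClassEdge T' a y b := by
  obtain ⟨i, j, hij, hi, hj⟩ := hab
  exact (h.edge hij).congr (h.rep_eq hi) (h.rep_eq hj)

theorem Extends.classPath (h : Extends T T') {a b : ℕ} {w : List (Letter g)}
    (hab : ClassPath T a w b) : ClassPath T' a w b := by
  induction w generalizing a with
  | nil => exact h.rep_eq hab
  | cons y w ih =>
    obtain ⟨c, hc, hcb⟩ := hab
    exact ⟨c, h.classEdge hc, ih hcb⟩

theorem Extends.refl (T : Table R) (hT : ∀ j, T.ρ j ≤ j) : Extends T T where
  ω_le := le_rfl
  rep_rep := RackEnum.rep_rep hT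
  edge := ClassEdge.of_entry
  reach := fun j h h' => absurd h (by omega)
  τ_eq := fun _ _ => rfl

theorem Extends.trans (h : Extends T T') (h' : Extends T' T'') : Extends T T'' where
  ω_le := h.ω_le.trans h'.ω_le
  rep_rep := fun i => by rw [← h'.rep_rep, h.rep_rep, h'.rep_rep]
  edge := fun hij => h'.classEdge (h.edge hij)
  reach := fun j hj hj' => by
    by_cases hjω : j ≤ T'.ω
    · obtain ⟨i, y, hij, he⟩ := h.reach j hj hjω
      exact ⟨i, y, hij, h'.classEdge he⟩
    · exact h'.reach j (by omega) hj'
  τ_eq := fun i hi => by rw [h'.τ_eq i (hi.trans h.ω_le), h.τ_eq i hi]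

/-- Dead rows never revive: the representative of a dead row is smaller than the row, and
representatives only decrease under extension. -/
theorem Extends.alive (h : Extends T T') (hT : ∀ j, T.ρ j ≤ j) {i : ℕ}
    (hi : T'.ρ i = i) : T.ρ i = i := by
  by_contra hne
  have h1 := rep_lt (lt_of_le_of_ne (hT i) hne)
  have h2 := h.rep_rep i
  rw [rep_of_eq hi] at h2
  have := rep_le T'.ρ (rep T.ρ i)
  omega

theorem Valid.τ_rep (hT : Valid T Q) (j : ℕ) : T.τ (rep T.ρ j) = T.τ j := by
  induction j using Nat.strong_induction_on with
  | _ j ih =>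
    rcases (hT.ρ_le j).lt_or_eq with h | h
    · rw [rep_of_lt h, ih _ h, hT.τ_ρ]
    · rw [rep_of_eq h]

theorem Valid.rep_mem_live (hT : Valid T Q) {j : ℕ} (h : 1 ≤ j) (h' : j ≤ T.ω) :
    rep T.ρ j ∈ T.live :=
  Table.mem_live.2 ⟨⟨rep_pos hT.ρ_pos h, (rep_le _ _).trans h'⟩, map_rep hT.ρ_le j⟩

theorem Valid.row_right (hT : Valid T Q) {i j : ℕ} {y : Letter g} (h : T.A i y = some j) :
    1 ≤ j ∧ j ≤ T.ω :=
  hT.row (hT.symm h)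

theorem Valid.mem_live_left (hT : Valid T []) {i j : ℕ} {y : Letter g} (h : T.A i y = some j) :
    i ∈ T.live :=
  Table.mem_live.2 ⟨hT.row h, by simpa using hT.dead h⟩

theorem Valid.mem_live_right (hT : Valid T []) {i j : ℕ} {y : Letter g} (h : T.A i y = some j) :
    j ∈ T.live :=
  hT.mem_live_left (hT.symm h)

theorem rep_of_mem_live {i : ℕ} (h : i ∈ T.live) : rep T.ρ i = i :=
  rep_of_eq (Table.mem_live.1 h).2

/-- With an empty queue only live rows have entries, and a live row is its own representative. -/
theorem classEdge_iff (hT : Valid T []) {a b : ℕ} {y : Letter g} :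
    ClassEdge T a y b ↔ T.A (rep T.ρ a) y = some (rep T.ρ b) := by
  constructor
  · rintro ⟨i, j, h, hi, hj⟩
    rw [← hi, ← hj, rep_of_mem_live (hT.mem_live_left h), rep_of_mem_live (hT.mem_live_right h), h]
  · exact fun h => ⟨_, _, h, rep_rep hT.ρ_le _, rep_rep hT.ρ_le _⟩

theorem Valid.τ_classPath (hT : Valid T Q) {a b : ℕ} {w : List (Letter g)}
    (h : ClassPath T a w b) : T.τ b = (T.τ a).map fun t => wordAct t w := by
  induction w generalizing a with
  | nil =>
    rw [← hT.τ_rep, ← show rep T.ρ a = rep T.ρ b from h, hT.τ_rep]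
    simp [wordAct]
  | cons y w ih =>
    obtain ⟨c, ⟨i, j, hij, hi, hj⟩, hc⟩ := h
    rw [ih hc, ← hT.τ_rep c, ← hj, hT.τ_rep, hT.τ_A hij, ← hT.τ_rep i, hi, hT.τ_rep,
      Option.map_map]
    rfl

theorem ClassPath.congr {a a' b b' : ℕ} {w : List (Letter g)} (h : ClassPath T a w b)
    (ha : rep T.ρ a = rep T.ρ a') (hb : rep T.ρ b = rep T.ρ b') : ClassPath T a' w b' := by
  induction w generalizing a a' with
  | nil => exact ha.symm.trans (Eq.trans h hb)
  | cons y w ih =>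
    obtain ⟨c, hc, h⟩ := h
    exact ⟨c, hc.congr ha rfl, ih h rfl⟩

theorem ClassPath.append {a b c : ℕ} {v w : List (Letter g)} (h : ClassPath T a v b)
    (h' : ClassPath T b w c) : ClassPath T a (v ++ w) c := by
  induction v generalizing a with
  | nil => exact h'.congr (Eq.symm h) rfl
  | cons y v ih =>
    obtain ⟨d, hd, h⟩ := h
    exact ⟨d, hd, ih h⟩

theorem ClassPath.invRev (hT : Valid T Q) {a b : ℕ} {w : List (Letter g)}
    (h : ClassPath T a w b) : ClassPath T b (FreeGroup.invRev w) a := by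
  induction w generalizing a with
  | nil => exact Eq.symm h
  | cons y w ih =>
    obtain ⟨c, hc, h⟩ := h
    rw [FreeGroup.invRev_cons]
    exact (ih h).append ⟨a, hc.symm hT, rfl⟩

end

/-! ### Deductions and definitions -/

theorem setEntry_A (T : Table R) (k : ℕ) (y : Letter g) (v : Option ℕ) (i : ℕ) (z : Letter g) :
    (T.setEntry k y v).A i z = if i = k ∧ z = y then v else T.A i z := by
  by_cases h : i = k
  · subst h
    by_cases h' : z = y <;> simp [Table.setEntry, h']
  · simp [Table.setEntry, h]

theorem deduction_A (T : Table R) (k : ℕ) (y : Letter g) (l i : ℕ) (z : Letter g) :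
    (deduction T k y l).A i z = if i = l ∧ z = y.bar then some k else
      if i = k ∧ z = y then some l else T.A i z := by
  rw [deduction, setEntry_A, setEntry_A]

section

variable {T : Table R} {Q : List ℕ} {k l : ℕ} {y : Letter g}

theorem Valid.deduction (hT : Valid T Q) (hk : k ∈ T.live) (hl : l ∈ T.live)
    (hA : T.A k y = none) (hA' : T.A l y.bar = none)
    (hτ : T.τ l = (T.τ k).map fun t => letterAct t y) : Valid (deduction T k y l) Q where
  ρ_le := hT.ρ_le
  ρ_pos := hT.ρ_pos
  ρ_of_gt := hT.ρ_of_gt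
  τ_ρ := hT.τ_ρ
  symm := by
    intro i z j h
    rw [deduction_A] at h ⊢
    split_ifs at h with h1 h2
    · obtain ⟨rfl, rfl⟩ := h1
      cases h
      -- The two assignments do not collide, even if `k = l`, because `ȳ ≠ y`.
      rw [if_neg, if_pos ⟨rfl, y.bar_bar⟩]
      rintro ⟨-, h⟩
      exact y.bar_ne (by rw [← h, Letter.bar_bar])
    · obtain ⟨rfl, rfl⟩ := h2
      cases h
      rw [if_pos ⟨rfl, rfl⟩]
    · have h3 := hT.symm h
      rw [if_neg, if_neg, h3]
      · rintro ⟨rfl, h4⟩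
        rw [h4, hA] at h3
        cases h3
      · rintro ⟨rfl, h4⟩
        rw [h4, hA'] at h3
        cases h3
  row := by
    intro i z j h
    rw [deduction_A] at h
    split_ifs at h with h1 h2
    · rw [h1.1]; exact (Table.mem_live.1 hl).1
    · rw [h2.1]; exact (Table.mem_live.1 hk).1
    · exact hT.row h
  τ_A := by
    intro i z j h
    rw [deduction_A] at h
    change T.τ j = (T.τ i).map _
    split_ifs at h with h1 h2
    · obtain ⟨rfl, rfl⟩ := h1
      cases h
      rw [hτ, Option.map_map]
      simp [Function.comp_def, letterAct_bar]
    · obtain ⟨rfl, rfl⟩ := h2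
      cases h
      exact hτ
    · exact hT.τ_A h
  dead := by
    intro i z j h
    rw [deduction_A] at h
    change T.ρ i = i ∨ _
    split_ifs at h with h1 h2
    · rw [h1.1]; exact Or.inl (Table.mem_live.1 hl).2
    · rw [h2.1]; exact Or.inl (Table.mem_live.1 hk).2
    · exact hT.dead h
  queue := hT.queue

theorem deduction_entry (T : Table R) (k : ℕ) (y : Letter g) (l : ℕ) :
    (deduction T k y l).A k y = some l := by
  rw [deduction_A, if_neg (fun h => y.bar_ne h.2.symm), if_pos ⟨rfl, rfl⟩]

theorem deduction_of_entry (hA : T.A k y = none) (hA' : T.A l y.bar = none) {i j : ℕ}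
    {z : Letter g} (h : T.A i z = some j) : (deduction T k y l).A i z = some j := by
  rw [deduction_A, if_neg, if_neg, h]
  · rintro ⟨rfl, rfl⟩
    rw [hA] at h; cases h
  · rintro ⟨rfl, rfl⟩
    rw [hA'] at h; cases h

theorem Extends.deduction (hT : Valid T Q) (hA : T.A k y = none) (hA' : T.A l y.bar = none) :
    Extends T (deduction T k y l) where
  ω_le := le_rfl
  rep_rep := RackEnum.rep_rep hT.ρ_le
  edge := fun h => ClassEdge.of_entry (deduction_of_entry hA hA' h)
  reach := fun j h h' => absurd h (by change j ≤ T.ω at h'; omega)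
  τ_eq := fun _ _ => rfl

/-- A new row without entries. -/
def addRow (T : Table R) (t : Option (PresentedRack R)) : Table R where
  ω := T.ω + 1
  A := T.A
  τ := Function.update T.τ (T.ω + 1) t
  ρ := Function.update T.ρ (T.ω + 1) (T.ω + 1)

/-- With this splitting, entries are written only by deductions, and the invariant need not be
checked again for DEFINE. -/
theorem define_eq (T : Table R) (k : ℕ) (y : Letter g) :
    define T k y =
      deduction (addRow T ((T.τ k).map fun x => letterAct x y)) k y (T.ω + 1) :=
  rfl

theorem Valid.addRow_ρ (hT : Valid T Q) (t : Option (PresentedRack R)) :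
    (addRow T t).ρ = T.ρ := by
  change Function.update _ _ _ = _
  rw [Function.update_eq_self_iff, hT.ρ_of_gt _ (Nat.lt_succ_self _)]

theorem Valid.addRow_τ (t : Option (PresentedRack R)) {i : ℕ} (hi : i ≤ T.ω) :
    (addRow T t).τ i = T.τ i :=
  Function.update_of_ne (by omega) _ _

theorem Valid.addRow (hT : Valid T Q) (t : Option (PresentedRack R)) : Valid (addRow T t) Q where
  ρ_le := by rw [hT.addRow_ρ]; exact hT.ρ_le
  ρ_pos := by rw [hT.addRow_ρ]; exact hT.ρ_pos
  ρ_of_gt := fun j hj => by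
    rw [hT.addRow_ρ]; exact hT.ρ_of_gt _ (lt_trans (Nat.lt_succ_self _) hj)
  τ_ρ := fun j => by
    rw [hT.addRow_ρ]
    by_cases hj : j ≤ T.ω
    · rw [addRow_τ _ hj, addRow_τ _ ((hT.ρ_le j).trans hj), hT.τ_ρ]
    · rw [hT.ρ_of_gt _ (by omega)]
  symm := hT.symm
  row := fun h => ⟨(hT.row h).1, (hT.row h).2.trans (Nat.le_succ _)⟩
  τ_A := fun h => by
    rw [addRow_τ _ (hT.row h).2, addRow_τ _ (hT.row_right h).2]; exact hT.τ_A h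
  dead := by rw [hT.addRow_ρ]; exact hT.dead
  queue := by rw [hT.addRow_ρ]; exact hT.queue

theorem Valid.A_eq_none (hT : Valid T Q) {i : ℕ} (hi : T.ω < i) (y : Letter g) :
    T.A i y = none := by
  by_contra h
  obtain ⟨j, hj⟩ := Option.ne_none_iff_exists'.1 h
  have := (hT.row hj).2
  omega

theorem Valid.define (hT : Valid T Q) (hk : k ∈ T.live) (hA : T.A k y = none) :
    Valid (define T k y) Q := by
  rw [define_eq]
  obtain ⟨⟨h1, h2⟩, h3⟩ := Table.mem_live.1 hk
  refine (hT.addRow _).deduction ?_ ?_ hA (hT.A_eq_none (Nat.lt_succ_self _) _) ?_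
  · rw [Table.mem_live, hT.addRow_ρ]
    exact ⟨⟨h1, h2.trans (Nat.le_succ _)⟩, h3⟩
  · rw [Table.mem_live, hT.addRow_ρ]
    exact ⟨⟨Nat.succ_pos _, le_rfl⟩, hT.ρ_of_gt _ (Nat.lt_succ_self _)⟩
  · rw [addRow_τ _ h2]
    exact Function.update_self ..

theorem define_ρ (hT : Valid T Q) (k : ℕ) (y : Letter g) : (define T k y).ρ = T.ρ :=
  hT.addRow_ρ ((T.τ k).map fun x => letterAct x y)

theorem define_entry (T : Table R) (k : ℕ) (y : Letter g) :
    (define T k y).A k y = some (T.ω + 1) := by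
  rw [define_eq]; exact deduction_entry (addRow T _) k y (T.ω + 1)

theorem Extends.define (hT : Valid T Q) (hk : k ∈ T.live) (hA : T.A k y = none) :
    Extends T (define T k y) where
  ω_le := Nat.le_succ _
  rep_rep := by rw [define_ρ hT]; exact RackEnum.rep_rep hT.ρ_le
  edge := fun h => ClassEdge.of_entry
    (deduction_of_entry (T := addRow T ((T.τ k).map fun x => letterAct x y)) hA
      (hT.A_eq_none (Nat.lt_succ_self _) _) h)
  reach := fun j h h' => by
    obtain rfl : j = T.ω + 1 := le_antisymm h' h
    have := (Table.mem_live.1 hk).1.2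
    exact ⟨k, y, by omega, ClassEdge.of_entry (define_entry T k y)⟩
  τ_eq := fun i hi => Valid.addRow_τ _ hi

theorem define_mem_live (hT : Valid T Q) {i : ℕ} (hi : i ∈ T.live) :
    i ∈ (RackEnum.define T k y).live := by
  rw [Table.mem_live] at hi ⊢
  rw [define_ρ hT]
  exact ⟨⟨hi.1.1, hi.1.2.trans (Nat.le_succ _)⟩, hi.2⟩

end

/-! ### Coincidences -/

section

variable {T : Table R} {Q : List ℕ}

theorem Valid.of_ρ (hT : Valid T Q) {ρ : ℕ → ℕ}
    (h : ∀ j, ρ j = T.ρ j ∨ ρ j = rep T.ρ j) : Valid { T with ρ := ρ } Q where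
  ρ_le j := by
    rcases h j with h | h
    · exact h.trans_le (hT.ρ_le j)
    · exact h.trans_le (rep_le _ j)
  ρ_pos j hj := by
    change 1 ≤ ρ j
    rcases h j with h | h
    · rw [h]; exact hT.ρ_pos j hj
    · rw [h]; exact rep_pos hT.ρ_pos hj
  ρ_of_gt j hj := by
    change ρ j = j
    rcases h j with h | h
    · rw [h, hT.ρ_of_gt j hj]
    · rw [h, rep_of_eq (hT.ρ_of_gt j hj)]
  τ_ρ j := by
    change T.τ (ρ j) = T.τ j
    rcases h j with h | h
    · rw [h, hT.τ_ρ]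
    · rw [h, hT.τ_rep]
  symm := hT.symm
  row := hT.row
  τ_A := hT.τ_A
  dead := by
    intro i y j hij
    change ρ i = i ∨ _
    refine (hT.dead hij).imp_left fun hi => ?_
    rcases h i with h | h
    · rw [h, hi]
    · rw [h, rep_of_eq hi]
  queue := by
    intro d hd
    change ρ d < d
    rcases h d with h | h
    · rw [h]; exact hT.queue d hd
    · rw [h]; exact rep_lt (hT.queue d hd)

theorem Valid.update (hT : Valid T Q) (i : ℕ) : Valid { T with ρ := update T.ρ i } Q :=
  hT.of_ρ (update_spec hT.ρ_le i)

theorem Valid.rep_update (hT : Valid T Q) (i : ℕ) : rep (RackEnum.update T.ρ i) = rep T.ρ :=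
  rep_congr hT.ρ_le (update_spec hT.ρ_le i)

/-- Remove `d^x = e` and `e^x̄ = d`. -/
def removeEntry (T : Table R) (d : ℕ) (x : Letter g) (e : ℕ) : Table R :=
  (T.setEntry d x none).setEntry e x.bar none

theorem removeEntry_A (T : Table R) (d : ℕ) (x : Letter g) (e i : ℕ) (z : Letter g) :
    (removeEntry T d x e).A i z =
      if (i = d ∧ z = x) ∨ (i = e ∧ z = x.bar) then none else T.A i z := by
  rw [removeEntry, setEntry_A, setEntry_A]
  split_ifs <;> tauto

theorem of_removeEntry {d e i j : ℕ} {x z : Letter g}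
    (h : (removeEntry T d x e).A i z = some j) : T.A i z = some j := by
  rw [removeEntry_A] at h
  split_ifs at h
  exact h

theorem Valid.removeEntry (hT : Valid T Q) {d e : ℕ} {x : Letter g} (hd : T.A d x = some e) :
    Valid (removeEntry T d x e) Q where
  ρ_le := hT.ρ_le
  ρ_pos := hT.ρ_pos
  ρ_of_gt := hT.ρ_of_gt
  τ_ρ := hT.τ_ρ
  symm := by
    intro i z j h
    have h' := of_removeEntry h
    rw [removeEntry_A] at h ⊢
    split_ifs at h with h1
    have h3 := hT.symm h
    rw [if_neg, h3]
    rintro (⟨rfl, rfl⟩ | ⟨rfl, h4⟩)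
    · rw [hd] at h3
      cases h3
      exact h1 (Or.inr ⟨rfl, z.bar_bar.symm⟩)
    · have h5 := hT.symm hd
      rw [← h4, h3] at h5
      cases h5
      exact h1 (Or.inl ⟨rfl, by rw [← z.bar_bar, h4, Letter.bar_bar]⟩)
  row := fun h => hT.row (of_removeEntry h)
  τ_A := fun h => hT.τ_A (of_removeEntry h)
  dead := fun h => hT.dead (of_removeEntry h)
  queue := hT.queue

/-- `(T', Q')` results from `(T, Q)` by a step in the resolution of coincidences, where `Q₀` are
other dead rows that may have entries. -/
structure Resolves (Q₀ : List ℕ) (s s' : Table R × List ℕ) : Prop where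
  valid : Valid s'.1 (Q₀ ++ s'.2)
  ext : Extends s.1 s'.1
  ω_eq : s'.1.ω = s.1.ω
  card_le : s'.1.live.card + s'.2.length ≤ s.1.live.card + s.2.length

theorem Resolves.trans {Q₀ : List ℕ} {s s' s'' : Table R × List ℕ} (h : Resolves Q₀ s s')
    (h' : Resolves Q₀ s' s'') : Resolves Q₀ s s'' where
  valid := h'.valid
  ext := h.ext.trans h'.ext
  ω_eq := h'.ω_eq.trans h.ω_eq
  card_le := h'.card_le.trans h.card_le

theorem Resolves.refl {Q₀ : List ℕ} {s : Table R × List ℕ} (h : Valid s.1 (Q₀ ++ s.2)) :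
    Resolves Q₀ s s :=
  ⟨h, Extends.refl _ h.ρ_le, rfl, le_rfl⟩

/-- Kill row `b`, which gets the representative `a`. -/
def kill (T : Table R) (b a : ℕ) : Table R :=
  { T with ρ := Function.update T.ρ b a }

theorem kill_ρ (T : Table R) (b a i : ℕ) : (kill T b a).ρ i = if i = b then a else T.ρ i :=
  Function.update_apply ..

theorem Valid.kill (hT : Valid T Q) {a b : ℕ} (hab : a < b) (ha : a ∈ T.live) (hb : b ∈ T.live)
    (hτ : T.τ a = T.τ b) {Q' : List ℕ} (hQ : ∀ d, d ∈ Q' ↔ d ∈ Q ∨ d = b) :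
    Valid (kill T b a) Q' where
  ρ_le j := by
    rw [kill_ρ]
    split_ifs with h
    · exact h ▸ hab.le
    · exact hT.ρ_le j
  ρ_pos j hj := by
    rw [kill_ρ]
    split_ifs with h
    · exact (Table.mem_live.1 ha).1.1
    · exact hT.ρ_pos j hj
  ρ_of_gt j hj := by
    have := (Table.mem_live.1 hb).1.2
    change T.ω < j at hj
    rw [kill_ρ, if_neg (by omega), hT.ρ_of_gt j hj]
  τ_ρ j := by
    rw [kill_ρ]
    split_ifs with h
    · rw [h]; exact hτ
    · exact hT.τ_ρ j
  symm := hT.symm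
  row := hT.row
  τ_A := hT.τ_A
  dead := by
    intro i y j hij
    rw [hQ, kill_ρ]
    split_ifs with h
    · exact Or.inr (Or.inr h)
    · exact (hT.dead hij).imp_right Or.inl
  queue := by
    intro d hd
    rw [kill_ρ]
    split_ifs with h
    · exact h ▸ hab
    · exact hT.queue d (((hQ d).1 hd).resolve_right h)

theorem Extends.kill (hT : Valid T Q) {a b : ℕ} (hab : a < b) (ha : a ∈ T.live)
    (hb : b ∈ T.live) : Extends T (kill T b a) where
  ω_le := le_rfl
  rep_rep i := by
    have h := fun j => rep_update_root hT.ρ_le hab (Table.mem_live.1 ha).2 (Table.mem_live.1 hb).2 j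
    change rep (Function.update T.ρ b a) _ = rep (Function.update T.ρ b a) _
    rw [h, h, RackEnum.rep_rep hT.ρ_le]
  edge h := ClassEdge.of_entry (T := RackEnum.kill T b a) h
  reach j h h' := absurd h (by change j ≤ T.ω at h'; omega)
  τ_eq _ _ := rfl

theorem card_live_kill {a b : ℕ} (hab : a < b) (hb : b ∈ T.live) :
    (kill T b a).live.card + 1 ≤ T.live.card := by
  refine Nat.succ_le_of_lt (Finset.card_lt_card ?_)
  refine (Finset.ssubset_iff_of_subset ?_).2 ⟨b, hb, ?_⟩
  · intro i hi
    rw [Table.mem_live, kill_ρ] at hi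
    rw [Table.mem_live]
    refine ⟨hi.1, ?_⟩
    have := hi.2
    split_ifs at this with h
    · omega
    · exact this
  · intro h
    have := (Table.mem_live.1 h).2
    rw [kill_ρ, if_pos rfl] at this
    omega

theorem merge_A (s : Table R × List ℕ) (m n : ℕ) : (merge s m n).1.A = s.1.A := by
  unfold merge
  dsimp only
  split_ifs <;> rfl

/-- A merge that does anything moves one row from the live set to the queue, which keeps the
termination measure from growing. Equal labels make the new pointer compatible with `τ`. -/
theorem resolves_merge {Q₀ : List ℕ} {s : Table R × List ℕ} (hs : Valid s.1 (Q₀ ++ s.2)) {m n : ℕ}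
    (hm : 1 ≤ m ∧ m ≤ s.1.ω) (hn : 1 ≤ n ∧ n ≤ s.1.ω) (hτ : s.1.τ m = s.1.τ n) :
    Resolves Q₀ s (merge s m n) ∧
      rep (merge s m n).1.ρ m = rep (merge s m n).1.ρ n := by
  obtain ⟨T, Q⟩ := s
  dsimp only at *
  have hμ := hs.rep_mem_live hm.1 hm.2
  have hν := hs.rep_mem_live hn.1 hn.2
  have hτ' : T.τ (rep T.ρ m) = T.τ (rep T.ρ n) := by rw [hs.τ_rep, hs.τ_rep, hτ]
  by_cases h : rep T.ρ m = rep T.ρ n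
  · have : merge (T, Q) m n = (T, Q) := by simp [merge, h]
    rw [this]
    exact ⟨Resolves.refl hs, h⟩
  · have : merge (T, Q) m n = (kill T (max (rep T.ρ m) (rep T.ρ n)) (min (rep T.ρ m) (rep T.ρ n)),
        Q ++ [max (rep T.ρ m) (rep T.ρ n)]) := by simp [merge, h, kill]
    rw [this]
    have hab : min (rep T.ρ m) (rep T.ρ n) < max (rep T.ρ m) (rep T.ρ n) := min_lt_max.2 h
    have ha : min (rep T.ρ m) (rep T.ρ n) ∈ T.live := by
      rcases min_choice (rep T.ρ m) (rep T.ρ n) with h | h <;> rw [h] <;> assumption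
    have hb : max (rep T.ρ m) (rep T.ρ n) ∈ T.live := by
      rcases max_choice (rep T.ρ m) (rep T.ρ n) with h | h <;> rw [h] <;> assumption
    have hτ'' : T.τ (min (rep T.ρ m) (rep T.ρ n)) = T.τ (max (rep T.ρ m) (rep T.ρ n)) := by
      rcases le_total (rep T.ρ m) (rep T.ρ n) with h | h
      · rw [min_eq_left h, max_eq_right h, hτ']
      · rw [min_eq_right h, max_eq_left h, hτ']
    refine ⟨⟨hs.kill hab ha hb hτ'' (by simp [or_assoc]), Extends.kill hs hab ha hb, rfl, ?_⟩, ?_⟩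
    · have := card_live_kill hab hb
      simp only [List.length_append, List.length_singleton]
      omega
    · change rep (Function.update _ _ _) _ = rep (Function.update _ _ _) _
      rw [rep_update_root hs.ρ_le hab (Table.mem_live.1 ha).2 (Table.mem_live.1 hb).2,
        rep_update_root hs.ρ_le hab (Table.mem_live.1 ha).2 (Table.mem_live.1 hb).2]
      rcases lt_or_gt_of_ne h with h | h
      · rw [min_eq_left h.le, max_eq_right h.le, if_neg h.ne, if_pos rfl]
      · rw [min_eq_right h.le, max_eq_left h.le, if_neg h.ne, if_pos rfl]

/-- The part of `coincidenceStep` after the entries `d^x = e` and `e^x̄ = d` are removed and the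
representatives `δ` and `ε` are found: put the edge back between `δ` and `ε`. -/
def restoreEdge (s : Table R × List ℕ) (δ ε : ℕ) (x : Letter g) : Table R × List ℕ :=
  match s.1.A δ x with
  | some f => merge s ε f
  | none =>
    match s.1.A ε x.bar with
    | some f => merge s δ f
    | none => (deduction s.1 δ x ε, s.2)

/-- If one end already has an entry for the letter, its target has the same label as the other end,
since letters act bijectively; merging the two turns the old entry into the wanted class edge.
Entries are written in live rows only. -/
theorem resolves_restoreEdge {Q₀ : List ℕ} {s : Table R × List ℕ} (hs : Valid s.1 (Q₀ ++ s.2))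
    {δ ε : ℕ} {x : Letter g} (hδ : δ ∈ s.1.live) (hε : ε ∈ s.1.live)
    (hτ : s.1.τ ε = (s.1.τ δ).map fun t => letterAct t x) :
    Resolves Q₀ s (restoreEdge s δ ε x) ∧ ClassEdge (restoreEdge s δ ε x).1 δ x ε ∧
      ∀ d z, d ∉ s.1.live → (restoreEdge s δ ε x).1.A d z = s.1.A d z := by
  have hδ' := Table.mem_live.1 hδ
  have hε' := Table.mem_live.1 hε
  unfold restoreEdge
  split
  · next f hf =>
    have h := resolves_merge hs hε'.1 (hs.row_right hf) (by rw [hτ, hs.τ_A hf])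
    refine ⟨h.1, ⟨δ, f, by rw [merge_A, hf], rfl, h.2.symm⟩, fun d z _ => by rw [merge_A]⟩
  · next hf =>
    split
    · next f hf' =>
      have h := resolves_merge hs hδ'.1 (hs.row_right hf') (by
        rw [hs.τ_A hf', hτ, Option.map_map]
        simp [Function.comp_def, letterAct_bar])
      refine ⟨h.1, ⟨f, ε, ?_, h.2.symm, rfl⟩, fun d z _ => by rw [merge_A]⟩
      have := hs.symm hf'
      rwa [merge_A, ← x.bar_bar]
    · next hf' =>
      refine ⟨⟨hs.deduction hδ hε hf hf' hτ, Extends.deduction hs hf hf', rfl, le_rfl⟩,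
        ClassEdge.of_entry (deduction_entry ..), fun d z hd => ?_⟩
      rw [deduction_A, if_neg, if_neg]
      · rintro ⟨rfl, -⟩; exact hd hδ
      · rintro ⟨rfl, -⟩; exact hd hε

theorem live_of_rep_eq {ρ : ℕ → ℕ} (hT : ∀ j, T.ρ j ≤ j) (hρ : ∀ j, ρ j ≤ j)
    (h : rep ρ = rep T.ρ) : ({ T with ρ := ρ } : Table R).live = T.live := by
  ext i
  rw [Table.mem_live, Table.mem_live, ← rep_eq_self_iff hT, ← h, rep_eq_self_iff hρ]

/-- Deleting `d^x = e` alone would break the order on tables. The edge is put back between the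
representatives of `d` and `e`, so it persists between classes. -/
theorem resolves_coincidenceStep {Q₀ : List ℕ} {s : Table R × List ℕ} {d : ℕ} (hd : d ∈ Q₀)
    (hs : Valid s.1 (Q₀ ++ s.2)) (x : Letter g) :
    Resolves Q₀ s (coincidenceStep d s x) ∧ (coincidenceStep d s x).1.A d x = none ∧
      ∀ z, s.1.A d z = none → (coincidenceStep d s x).1.A d z = none := by
  obtain ⟨T, Q⟩ := s
  dsimp only at hs ⊢
  cases he : T.A d x with
  | none =>
    have : coincidenceStep d (T, Q) x = (T, Q) := by simp [coincidenceStep, he]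
    rw [this]
    exact ⟨Resolves.refl hs, he, fun _ => id⟩
  | some e =>
    set ρ₂ := update T.ρ d with hρ₂
    set ρ₃ := update ρ₂ e with hρ₃
    have hv₂ : Valid { removeEntry T d x e with ρ := ρ₂ } (Q₀ ++ Q) := (hs.removeEntry he).update d
    have hv₃ : Valid { removeEntry T d x e with ρ := ρ₃ } (Q₀ ++ Q) := hv₂.update e
    have hr₂ : rep ρ₂ = rep T.ρ := hs.rep_update d
    have hr₃ : rep ρ₃ = rep T.ρ := (hv₂.rep_update e).trans hr₂
    have hstep : coincidenceStep d (T, Q) x =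
        restoreEdge ({ removeEntry T d x e with ρ := ρ₃ }, Q) (rep T.ρ d) (rep ρ₂ e) x := by
      simp only [coincidenceStep, he]
      rfl
    have hlive : ({ removeEntry T d x e with ρ := ρ₃ } : Table R).live = T.live := by
      rw [live_of_rep_eq (T := removeEntry T d x e) hs.ρ_le hv₃.ρ_le hr₃]
      rfl
    rw [hr₂] at hstep
    have hd' := hs.row he
    have he' := hs.row_right he
    have hδ := hs.rep_mem_live hd'.1 hd'.2
    have hε := hs.rep_mem_live he'.1 he'.2
    obtain ⟨h1, h2, h3⟩ := resolves_restoreEdge (s := ({ removeEntry T d x e with ρ := ρ₃ }, Q))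
      (x := x) hv₃ (δ := rep T.ρ d) (ε := rep T.ρ e) (by rwa [hlive]) (by rwa [hlive]) (by
        change T.τ _ = (T.τ _).map _
        rw [hs.τ_rep, hs.τ_rep, hs.τ_A he])
    rw [← hstep] at h1 h2 h3
    have hdl : d ∉ ({ removeEntry T d x e with ρ := ρ₃ } : Table R).live := by
      rw [hlive, Table.mem_live]
      have := hs.queue d (List.mem_append_left _ hd)
      omega
    have hrep : ∀ i, rep (coincidenceStep d (T, Q) x).1.ρ (rep T.ρ i) =
        rep (coincidenceStep d (T, Q) x).1.ρ i := by
      intro i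
      have := h1.ext.rep_rep i
      dsimp only at this
      rwa [hr₃] at this
    -- The edge restored between the representatives joins the classes of `d` and `e`, and so
    -- replaces both deleted entries.
    have hedge : ClassEdge (coincidenceStep d (T, Q) x).1 d x e := h2.congr (hrep d) (hrep e)
    refine ⟨⟨h1.valid, ⟨h1.ext.ω_le, hrep, ?_, h1.ext.reach, h1.ext.τ_eq⟩, h1.ω_eq, ?_⟩, ?_, ?_⟩
    · intro i y j hij
      by_cases hi : (i = d ∧ y = x) ∨ (i = e ∧ y = x.bar)
      · rcases hi with ⟨rfl, rfl⟩ | ⟨rfl, rfl⟩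
        · rw [he] at hij
          cases hij
          exact hedge
        · rw [hs.symm he] at hij
          cases hij
          exact hedge.symm h1.valid
      · refine h1.ext.edge (?_ : (removeEntry T d x e).A i y = some j)
        rw [removeEntry_A, if_neg hi, hij]
    · have := h1.card_le
      rwa [hlive] at this
    · rw [h3 d x hdl]
      change (removeEntry T d x e).A d x = none
      rw [removeEntry_A, if_pos (Or.inl ⟨rfl, rfl⟩)]
    · intro z hz
      rw [h3 d z hdl]
      change (removeEntry T d x e).A d z = none
      rw [removeEntry_A, hz, ite_self]

/-- Cleared entries of the dead row `d` stay cleared, so a pass through all letters empties the row.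
-/
theorem resolves_foldl {Q₀ : List ℕ} {d : ℕ} (hd : d ∈ Q₀) (letters : List (Letter g)) :
    ∀ s : Table R × List ℕ, Valid s.1 (Q₀ ++ s.2) →
      Resolves Q₀ s (letters.foldl (coincidenceStep d) s) ∧
      ∀ z, (z ∈ letters ∨ s.1.A d z = none) →
        (letters.foldl (coincidenceStep d) s).1.A d z = none := by
  induction letters with
  | nil => exact fun s hs => ⟨Resolves.refl hs, by simp⟩
  | cons x letters ih =>
    intro s hs
    obtain ⟨h1, h2, h3⟩ := resolves_coincidenceStep hd hs x
    obtain ⟨h4, h5⟩ := ih _ h1.valid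
    refine ⟨h1.trans h4, fun z hz => h5 z ?_⟩
    rcases hz with hz | hz
    · rcases List.mem_cons.1 hz with rfl | hz
      · exact Or.inr h2
      · exact Or.inl hz
    · exact Or.inr (h3 z hz)

/-- The loop of COINCIDENCE terminates. -/
theorem exists_mem_coincidenceLoop {letters : List (Letter g)} (hl : ∀ y, y ∈ letters) (N : ℕ) :
    ∀ (T : Table R) (Q : List ℕ), Valid T Q → T.live.card + Q.length ≤ N →
      ∃ T' ∈ coincidenceLoop letters (T, Q), Valid T' [] ∧ Extends T T' ∧ T'.ω = T.ω := by
  induction N with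
  | zero =>
    intro T Q hT hN
    obtain rfl : Q = [] := List.length_eq_zero_iff.1 (by omega)
    exact ⟨T, PFun.mem_fix_iff.2 (Or.inl (Part.mem_some _)), hT, Extends.refl T hT.ρ_le, rfl⟩
  | succ N ih =>
    intro T Q hT hN
    cases Q with
    | nil =>
      exact ⟨T, PFun.mem_fix_iff.2 (Or.inl (Part.mem_some _)), hT, Extends.refl T hT.ρ_le, rfl⟩
    | cons d Q =>
      obtain ⟨h1, h2⟩ := resolves_foldl (List.mem_singleton_self d) letters (T, Q) hT
      set s := letters.foldl (coincidenceStep d) (T, Q) with hs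
      -- Row `d` has no entries left, so it can be dropped from the list of dead rows that may have
      -- some.
      have hv : Valid s.1 s.2 :=
        { h1.valid with
          dead := fun {i y j} hij => by
            refine (h1.valid.dead hij).imp_right fun h => ?_
            rcases List.mem_cons.1 h with rfl | h
            · rw [h2 y (Or.inl (hl y))] at hij
              cases hij
            · exact h
          queue := fun d' hd' => h1.valid.queue d' (List.mem_cons_of_mem _ hd') }
      -- The pass does not raise live rows plus queue length, and taking `d` off the queue has
      -- lowered it by one.
      have hc := h1.card_le
      rw [List.length_cons] at hN
      dsimp only at hc
      obtain ⟨T', h3, h4, h5, h6⟩ := ih s.1 s.2 hv (by omega)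
      exact ⟨T', PFun.mem_fix_iff.2 (Or.inr ⟨s, Part.mem_some _, h3⟩), h4, h1.ext.trans h5,
        h6.trans h1.ω_eq⟩

theorem exists_mem_coincidence {letters : List (Letter g)} (hl : ∀ y, y ∈ letters)
    (hT : Valid T []) {m n : ℕ} (hm : 1 ≤ m ∧ m ≤ T.ω) (hn : 1 ≤ n ∧ n ≤ T.ω)
    (hτ : T.τ m = T.τ n) :
    ∃ T' ∈ coincidence letters T m n, Valid T' [] ∧ Extends T T' ∧
      rep T'.ρ m = rep T'.ρ n := by
  obtain ⟨h1, h2⟩ := resolves_merge (Q₀ := []) (s := (T, [])) hT hm hn hτ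
  obtain ⟨T', h3, h4, h5, -⟩ := exists_mem_coincidenceLoop hl _ _ _ h1.valid le_rfl
  exact ⟨T', h3, h4, h1.ext.trans h5, h5.rep_eq h2⟩

end

/-! ### Scanning -/

section

variable {T : Table R} {letters : List (Letter g)}

theorem scanForward_spec (hT : Valid T []) (v : List (Letter g)) {k : ℕ} (hk : k ∈ T.live) :
    ∃ u, v = u ++ (scanForward T.A k v).2 ∧ ClassPath T k u (scanForward T.A k v).1 ∧
      (scanForward T.A k v).1 ∈ T.live ∧
      ∀ y w, (scanForward T.A k v).2 = y :: w → T.A (scanForward T.A k v).1 y = none := by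
  induction v generalizing k with
  | nil => exact ⟨[], rfl, rfl, hk, fun y w h => by cases h⟩
  | cons x v ih =>
    rw [scanForward]
    cases hx : T.A k x with
    | none =>
      exact ⟨[], rfl, rfl, hk, fun y w h => by cases h; exact hx⟩
    | some k' =>
      obtain ⟨u, h1, h2, h3, h4⟩ := ih (hT.mem_live_right hx)
      exact ⟨x :: u, congrArg (List.cons x) h1, ⟨k', ClassEdge.of_entry hx, h2⟩, h3, h4⟩

theorem scanBackward_spec (hT : Valid T []) (v : List (Letter g)) {l : ℕ} (hl : l ∈ T.live) :
    ∃ u, v = (scanBackward T.A l v).2 ++ u ∧ ClassPath T (scanBackward T.A l v).1 u l ∧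
      (scanBackward T.A l v).1 ∈ T.live ∧
      ∀ y w, (scanBackward T.A l v).2 = w ++ [y] →
        T.A (scanBackward T.A l v).1 y.bar = none := by
  obtain ⟨u, h1, h2, h3, h4⟩ := scanForward_spec hT (FreeGroup.invRev v) hl
  refine ⟨FreeGroup.invRev u, ?_, h2.invRev hT, h3, fun y w h => h4 _ (FreeGroup.invRev w) ?_⟩
  · have := congrArg FreeGroup.invRev h1
    rwa [FreeGroup.invRev_invRev, FreeGroup.invRev_append] at this
  · have := congrArg FreeGroup.invRev h
    rw [scanBackward, FreeGroup.invRev_invRev, FreeGroup.invRev_append] at this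
    exact this

theorem scanStep_of_ne_nil (T : Table R) (k : ℕ) {v : List (Letter g)} (hv : v ≠ []) (l : ℕ) :
    scanStep letters (T, k, v, l) =
      match (scanBackward T.A l (scanForward T.A k v).2).2 with
      | [] =>
        if (scanForward T.A k v).1 ≠ (scanBackward T.A l (scanForward T.A k v).2).1 then
          (coincidence letters T (scanForward T.A k v).1
            (scanBackward T.A l (scanForward T.A k v).2).1).map Sum.inl
        else Part.some (Sum.inl T)
      | [y] => Part.some (Sum.inl (deduction T (scanForward T.A k v).1 y
          (scanBackward T.A l (scanForward T.A k v).2).1))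
      | y :: y' :: v' => Part.some (Sum.inr (define T (scanForward T.A k v).1 y,
          (scanForward T.A k v).1, y :: y' :: v',
          (scanBackward T.A l (scanForward T.A k v).2).1)) := by
  cases v with
  | nil => exact absurd rfl hv
  | cons y v => rfl

/-- A round that ends with DEFINE need not shorten the word, but the next one does, as it can read
the new entry. The last hypothesis therefore allows length `n` only if the first letter can be read.
-/
theorem exists_mem_fix_scanStep (hl : ∀ y, y ∈ letters) (n : ℕ) :
    ∀ (T : Table R) (k : ℕ) (v : List (Letter g)) (l : ℕ), Valid T [] → k ∈ T.live →
      l ∈ T.live → v ≠ [] → T.τ l = (T.τ k).map (fun t => wordAct t v) →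
      (v.length < n ∨ v.length = n ∧ ∃ y w, v = y :: w ∧ T.A k y ≠ none) →
      ∃ T' ∈ PFun.fix (scanStep letters) (T, k, v, l),
        Valid T' [] ∧ Extends T T' ∧ ClassPath T' k v l := by
  induction n with
  | zero =>
    intro T k v l _ _ _ hv _ hn
    have := List.length_pos_iff.2 hv
    omega
  | succ n ih =>
    intro T k v l hT hk hlv hv hτ hn
    obtain ⟨u, hu, hku, hk', hku'⟩ := scanForward_spec hT v hk
    obtain ⟨u', hu', hlu, hl', hlu'⟩ := scanBackward_spec hT (scanForward T.A k v).2 hlv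
    have hstep := scanStep_of_ne_nil (letters := letters) T k hv l
    generalize scanBackward T.A l (scanForward T.A k v).2 = q at *
    generalize scanForward T.A k v = p at *
    obtain ⟨k', v₁⟩ := p
    obtain ⟨l', v₂⟩ := q
    dsimp only at *
    subst hu'
    have hτ' : T.τ l' = (T.τ k').map fun t => wordAct t v₂ := by
      rw [hT.τ_classPath (hlu.invRev hT), hτ, hT.τ_classPath hku, Option.map_map, Option.map_map]
      congr 1
      funext t
      rw [Function.comp_apply, Function.comp_apply, hu, wordAct_append, wordAct_append_invRev]
    have hfin : ∀ T' : Table R, Extends T T' → ClassPath T' k' v₂ l' → ClassPath T' k v l := by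
      intro T' hTT' h
      rw [hu]
      exact (hTT'.classPath hku).append (h.append (hTT'.classPath hlu))
    match v₂ with
    | [] =>
      dsimp only at hstep
      by_cases hkl : k' = l'
      · rw [if_neg (not_not.2 hkl)] at hstep
        exact ⟨T, PFun.mem_fix_iff.2 (Or.inl (hstep ▸ Part.mem_some _)), hT,
          Extends.refl T hT.ρ_le, hfin T (Extends.refl T hT.ρ_le) (congrArg _ hkl)⟩
      · rw [if_pos hkl] at hstep
        obtain ⟨T', h1, h2, h3, h4⟩ := exists_mem_coincidence hl hT (Table.mem_live.1 hk').1
          (Table.mem_live.1 hl').1 (by rw [hτ']; simp [wordAct])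
        exact ⟨T', PFun.mem_fix_iff.2 (Or.inl (hstep ▸ Part.mem_map _ h1)), h2, h3, hfin T' h3 h4⟩
    | [y] =>
      dsimp only at hstep
      have hy := hku' y u' rfl
      have hy' := hlu' y [] rfl
      have hext := Extends.deduction (l := l') hT hy hy'
      exact ⟨_, PFun.mem_fix_iff.2 (Or.inl (hstep ▸ Part.mem_some _)),
        hT.deduction hk' hl' hy hy' hτ', hext,
        hfin _ hext ⟨l', ClassEdge.of_entry (deduction_entry ..), rfl⟩⟩
    | y :: y' :: v' =>
      dsimp only at hstep
      have hy := hku' y (y' :: v' ++ u') rfl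
      have hext := Extends.define hT hk' hy
      have hω := (Table.mem_live.1 hk').1.2
      have hω' := (Table.mem_live.1 hl').1.2
      have hlen := congrArg List.length hu
      simp only [List.length_append] at hlen
      obtain ⟨T', h1, h2, h3, h4⟩ := ih (define T k' y) k' (y :: y' :: v') l' (hT.define hk' hy)
        (define_mem_live hT hk') (define_mem_live hT hl') (by simp)
        (by rw [hext.τ_eq _ hω, hext.τ_eq _ hω', hτ']) (by
          -- The first letter has just been made readable, so it remains to bound the length by `n`.
          rw [← Nat.le_iff_lt_or_eq.trans (or_congr_right (iff_self_and.2 fun _ =>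
            ⟨y, y' :: v', rfl, by rw [define_entry]; simp⟩))]
          rcases hn with hn | ⟨hn, z, w, rfl, hz⟩
          · omega
          -- In the case of equality the first letter was readable, so the forward scan cannot have
          -- read the empty word.
          · cases u with
            | nil =>
              cases hu
              have : k = k' := by
                rw [← rep_of_mem_live hk, ← rep_of_mem_live hk']; exact hku
              rw [this] at hz
              exact absurd hy hz
            | cons _ _ =>
              simp only [List.length_cons] at hlen hn ⊢
              omega)
      exact ⟨T', PFun.mem_fix_iff.2 (Or.inr ⟨_, hstep ▸ Part.mem_some _, h1⟩), h2, hext.trans h3,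
        hfin T' (hext.trans h3) h4⟩

/-- SCAN does nothing on an empty word, even if its two ends differ; `hw` excludes this. It is the
reason for forbidding relations `x_i = x_j` with `i ≠ j`. -/
theorem exists_mem_scan (hl : ∀ y, y ∈ letters) (hT : Valid T []) {i j : ℕ} (hi : i ∈ T.live)
    (hj : j ∈ T.live) {w : List (Letter g)} (hτ : T.τ j = (T.τ i).map (fun t => wordAct t w))
    (hw : w = [] → i = j) :
    ∃ T' ∈ scan letters T i w j, Valid T' [] ∧ Extends T T' ∧ ClassPath T' i w j := by
  by_cases h : w = []
  · subst h
    exact ⟨T, PFun.mem_fix_iff.2 (Or.inl (Part.mem_some _)), hT, Extends.refl T hT.ρ_le,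
      congrArg _ (hw rfl)⟩
  · exact exists_mem_fix_scanStep hl (w.length + 1) T i w j hT hi hj h hτ
      (Or.inl (Nat.lt_succ_self _))

end

/-! ### The loops of the enumeration process -/

theorem valid_init (R : Finset (Relation g)) : Valid (init R) [] where
  ρ_le _ := le_rfl
  ρ_pos _ := id
  ρ_of_gt _ _ := rfl
  τ_ρ _ := rfl
  symm h := by cases h
  row h := by cases h
  τ_A h := by cases h
  dead _ := Or.inl rfl
  queue := by simp

theorem init_τ (s : Fin g) : (init R).τ (s + 1) = some (generator R s) :=
  dif_pos ⟨by simp, by simp⟩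

theorem Extends.τ_generator {T : Table R} (hT : Extends (init R) T) (s : Fin g) :
    T.τ (s + 1) = some (generator R s) := by
  rw [hT.τ_eq (s + 1) s.2, init_τ]

theorem exists_mem_scanPrimary (o : LoopOrder R) (hR : ∀ r ∈ R, r.u = 1 → r.i = r.j) :
    ∃ T ∈ scanPrimary o (init R), Valid T [] ∧ Extends (init R) T ∧
      ∀ r ∈ R, ClassPath T (r.i + 1) r.u.toWord (r.j + 1) := by
  suffices H : ∀ (rs : List (Relation g)) (T : Table R), (∀ r ∈ rs, r ∈ R) → Valid T [] →
      Extends (init R) T → ∃ T' ∈ (rs.foldlM (fun T r => scan o.letters T (rep T.ρ (r.i + 1))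
        r.u.toWord (rep T.ρ (r.j + 1))) T : Part (Table R)), Valid T' [] ∧ Extends T T' ∧
        ∀ r ∈ rs, ClassPath T' (r.i + 1) r.u.toWord (r.j + 1) by
    obtain ⟨T, h1, h2, h3, h4⟩ := H o.primary (init R) (fun r => (o.mem_primary r).1)
      (valid_init R) (Extends.refl _ (valid_init R).ρ_le)
    exact ⟨T, h1, h2, h3, fun r hr => h4 r ((o.mem_primary r).2 hr)⟩
  intro rs
  induction rs with
  | nil => exact fun T _ hT _ => ⟨T, Part.mem_some _, hT, Extends.refl T hT.ρ_le, by simp⟩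
  | cons r rs ih =>
    intro T hrs hT hext
    have hr : r ∈ R := hrs r List.mem_cons_self
    have hrow : ∀ s : Fin g, rep T.ρ (s + 1) ∈ T.live := fun s =>
      hT.rep_mem_live (Nat.succ_pos _) (le_trans (Nat.succ_le_of_lt s.2) hext.ω_le)
    obtain ⟨T₁, h1, h2, h3, h4⟩ := exists_mem_scan o.mem_letters hT (hrow r.i) (hrow r.j)
      (w := r.u.toWord) (by
        rw [hT.τ_rep, hT.τ_rep, hext.τ_generator, hext.τ_generator, Option.map_some,
          wordAct_relation hr])
      (fun h => by rw [hR r hr (FreeGroup.toWord_eq_nil_iff.1 h)])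
    obtain ⟨T₂, h5, h6, h7, h8⟩ := ih T₁ (fun r' hr' => hrs r' (List.mem_cons_of_mem _ hr')) h2
      (hext.trans h3)
    refine ⟨T₂, ?_, h6, h3.trans h7, fun r' hr' => ?_⟩
    · rw [List.foldlM_cons]
      exact Part.mem_bind_iff.2 ⟨T₁, h1, h5⟩
    · rcases List.mem_cons.1 hr' with rfl | hr'
      · exact (h7.classPath h4).congr ((h3.trans h7).rep_rep _) ((h3.trans h7).rep_rep _)
      · exact h8 r' hr'

/-- Row `i` may die during a scan and cut the loop short. The paths are then not needed, hence the
condition that `i` be live at the end. -/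
theorem exists_mem_scanSecondary {letters : List (Letter g)} (hl : ∀ y, y ∈ letters) (i : ℕ) :
    ∀ (ws : List (FreeGroup (Fin g))) (T : Table R), (∀ w ∈ ws, w ∈ secondaryRelations R) →
      Valid T [] → ∃ T' ∈ scanSecondary letters i ws T, Valid T' [] ∧ Extends T T' ∧
        (i ∈ T'.live → ∀ w ∈ ws, ClassPath T' i w.toWord i) := by
  intro ws
  induction ws with
  | nil => exact fun T _ hT => ⟨T, Part.mem_some _, hT, Extends.refl T hT.ρ_le, by simp⟩
  | cons w ws ih =>
    intro T hws hT
    rw [scanSecondary]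
    split_ifs with hi
    · obtain ⟨T₁, h1, h2, h3, h4⟩ := exists_mem_scan hl hT hi hi (w := w.toWord) (by
        simp_rw [wordAct_secondary (hws w List.mem_cons_self)]
        simp) (fun _ => rfl)
      obtain ⟨T₂, h5, h6, h7, h8⟩ := ih T₁ (fun w' hw' => hws w' (List.mem_cons_of_mem _ hw')) h2
      refine ⟨T₂, Part.mem_bind_iff.2 ⟨T₁, h1, h5⟩, h6, h3.trans h7, fun hi' w' hw' => ?_⟩
      rcases List.mem_cons.1 hw' with rfl | hw'
      · exact h7.classPath h4
      · exact h8 hi' w' hw'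
    · exact ⟨T, Part.mem_some _, hT, Extends.refl T hT.ρ_le, fun h => absurd h hi⟩

theorem fillRow_spec {letters : List (Letter g)} (hl : ∀ y, y ∈ letters) (i : ℕ) {T : Table R}
    (hT : Valid T []) : Valid (fillRow letters i T) [] ∧ Extends T (fillRow letters i T) ∧
      (i ∈ T.live → ∀ y, (fillRow letters i T).A i y ≠ none) := by
  rw [fillRow]
  split_ifs with hi
  · suffices H : ∀ (ls : List (Letter g)) (T : Table R), Valid T [] → i ∈ T.live →
        Valid (ls.foldl (fun T y => if T.A i y = none then define T i y else T) T) [] ∧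
        Extends T (ls.foldl (fun T y => if T.A i y = none then define T i y else T) T) ∧
        ∀ y, (y ∈ ls ∨ T.A i y ≠ none) →
          (ls.foldl (fun T y => if T.A i y = none then define T i y else T) T).A i y ≠ none by
      obtain ⟨h1, h2, h3⟩ := H letters T hT hi
      exact ⟨h1, h2, fun _ y => h3 y (Or.inl (hl y))⟩
    intro ls
    induction ls with
    | nil => exact fun T hT _ => ⟨hT, Extends.refl T hT.ρ_le, by simp⟩
    | cons x ls ih =>
      intro T hT hi
      rw [List.foldl_cons]
      split_ifs with hx
      · obtain ⟨h1, h2, h3⟩ := ih _ (hT.define hi hx) (define_mem_live hT hi)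
        refine ⟨h1, (Extends.define hT hi hx).trans h2, fun y hy => h3 y ?_⟩
        rw [or_iff_not_imp_left]
        intro hy'
        by_cases hyx : y = x
        · rw [hyx, define_entry]; simp
        · obtain ⟨j, hj⟩ := Option.ne_none_iff_exists'.1
            (hy.resolve_left (fun h => (List.mem_cons.1 h).elim hyx hy'))
          have := deduction_of_entry (T := addRow T ((T.τ i).map fun t => letterAct t x)) hx
            (hT.A_eq_none (Nat.lt_succ_self _) x.bar) hj
          rw [define_eq]
          exact Option.ne_none_iff_exists'.2 ⟨j, this⟩
      · obtain ⟨h1, h2, h3⟩ := ih T hT hi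
        refine ⟨h1, h2, fun y hy => h3 y ?_⟩
        rcases hy with hy | hy
        · rcases List.mem_cons.1 hy with rfl | hy
          · exact Or.inr hx
          · exact Or.inl hy
        · exact Or.inr hy
  · exact ⟨hT, Extends.refl T hT.ρ_le, fun h => absurd h hi⟩

/-- The table `T'` extends `T` and row `i` of `T'` is dead, or it is filled and satisfies the
secondary relations. -/
structure Processes (i : ℕ) (T T' : Table R) : Prop where
  ext : Extends T T'
  path : T'.ρ i = i → ∀ w ∈ secondaryRelations R, ClassPath T' i w.toWord i
  filled : T'.ρ i = i → ∀ y, T'.A i y ≠ none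

theorem exists_process (o : LoopOrder R) {i : ℕ} {T : Table R} (hT : Valid T []) (hi : 1 ≤ i)
    (hi' : i ≤ T.ω) :
    ∃ T₁ ∈ scanSecondary o.letters i o.secondary T,
      Valid (fillRow o.letters i T₁) [] ∧ Processes i T (fillRow o.letters i T₁) := by
  obtain ⟨T₁, h1, h2, h3, h4⟩ := exists_mem_scanSecondary o.mem_letters i o.secondary T
    (fun w => (o.mem_secondary w).1) hT
  obtain ⟨h5, h6, h7⟩ := fillRow_spec o.mem_letters i h2
  have hlive : (fillRow o.letters i T₁).ρ i = i → i ∈ T₁.live := fun h =>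
    Table.mem_live.2 ⟨⟨hi, hi'.trans h3.ω_le⟩, h6.alive h2.ρ_le h⟩
  exact ⟨T₁, h1, h5, h3.trans h6,
    fun h w hw => h6.classPath (h4 (hlive h) w ((o.mem_secondary w).2 hw)),
    fun h => h7 (hlive h)⟩

theorem Table.le_maxLive {T : Table R} {i : ℕ} (h : i ∈ T.live) : i ≤ T.maxLive :=
  Finset.le_sup (f := id) h

theorem Table.maxLive_le {T : Table R} {n : ℕ} (h : ∀ i ∈ T.live, i ≤ n) : T.maxLive ≤ n :=
  Finset.sup_le h

theorem Table.maxLive_le_ω (T : Table R) : T.maxLive ≤ T.ω :=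
  Table.maxLive_le fun _ h => (Table.mem_live.1 h).1.2

/-- `U n` is the table at the start of the round of the main loop for row `n + 1`. After all rows
are processed, the sequence is constant. -/
structure IsRun (o : LoopOrder R) (U : ℕ → Table R) : Prop where
  valid : ∀ n, Valid (U n) []
  ext : ∀ n, Extends (U n) (U (n + 1))
  processes : ∀ n, n + 1 ≤ (U n).maxLive → Processes (n + 1) (U n) (U (n + 1))
  step : ∀ n, n + 1 ≤ (U n).maxLive → ∃ T₁ ∈ scanSecondary o.letters (n + 1) o.secondary (U n),
    U (n + 1) = fillRow o.letters (n + 1) T₁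

/-- The run has no limit `M`. Each round terminates on a valid table, so the sequence comes from
recursion on valid tables. -/
theorem exists_isRun (o : LoopOrder R) {T₀ : Table R} (hT₀ : Valid T₀ []) :
    ∃ U : ℕ → Table R, U 0 = T₀ ∧ IsRun o U := by
  have H : ∀ (n : ℕ) (T : {T : Table R // Valid T []}), ∃ T' : {T : Table R // Valid T []},
      Extends T.1 T'.1 ∧ (n + 1 ≤ T.1.maxLive → Processes (n + 1) T.1 T'.1) ∧
        (n + 1 ≤ T.1.maxLive → ∃ T₁ ∈ scanSecondary o.letters (n + 1) o.secondary T.1,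
          T'.1 = fillRow o.letters (n + 1) T₁) := by
    intro n T
    by_cases h : n + 1 ≤ T.1.maxLive
    · obtain ⟨T₁, h1, h2, h3⟩ := exists_process o T.2 (Nat.succ_pos n)
        (h.trans T.1.maxLive_le_ω)
      exact ⟨⟨_, h2⟩, h3.ext, fun _ => h3, fun _ => ⟨T₁, h1, rfl⟩⟩
    · exact ⟨T, Extends.refl T.1 T.2.ρ_le, fun h' => absurd h' h, fun h' => absurd h' h⟩
  choose next h1 h2 h3 using H
  let V : ℕ → {T : Table R // Valid T []} := fun n => Nat.rec ⟨T₀, hT₀⟩ next n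
  exact ⟨fun n => (V n).1, rfl, fun n => (V n).2, fun n => h1 n (V n), fun n => h2 n (V n),
    fun n => h3 n (V n)⟩

theorem IsRun.mono {o : LoopOrder R} {U : ℕ → Table R} (hU : IsRun o U) {m n : ℕ} (h : m ≤ n) :
    Extends (U m) (U n) := by
  induction n, h using Nat.le_induction with
  | base => exact Extends.refl _ (hU.valid m).ρ_le
  | succ n _ ih => exact ih.trans (hU.ext n)

theorem mainLoop_eq_some {o : LoopOrder R} {M i : ℕ} {T : Table R}
    (h : ¬(i ≤ T.maxLive ∧ i ≤ M)) : mainLoop o M i T = Part.some (i, T) := by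
  rw [mainLoop, dif_neg h]

theorem mem_mainLoop_of_mem {o : LoopOrder R} {M i : ℕ} {T T₁ : Table R} {p : ℕ × Table R}
    (h : i ≤ T.maxLive ∧ i ≤ M) (h₁ : T₁ ∈ scanSecondary o.letters i o.secondary T)
    (hp : p ∈ mainLoop o M (i + 1) (fillRow o.letters i T₁)) : p ∈ mainLoop o M i T := by
  rw [mainLoop, dif_pos h]
  exact Part.mem_bind_iff.2 ⟨T₁, h₁, hp⟩

theorem exists_mem_mainLoop (o : LoopOrder R) (M : ℕ) (k : ℕ) :
    ∀ (i : ℕ) (T : Table R), M + 1 - i = k → 1 ≤ i → Valid T [] →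
      ∃ p ∈ mainLoop o M i T, Valid p.2 [] ∧ Extends T p.2 := by
  induction k with
  | zero =>
    intro i T hk _ hT
    exact ⟨(i, T), by rw [mainLoop_eq_some (by omega)]; exact Part.mem_some _, hT,
      Extends.refl T hT.ρ_le⟩
  | succ k ih =>
    intro i T hk hi hT
    by_cases h : i ≤ T.maxLive ∧ i ≤ M
    · obtain ⟨T₁, h1, h2, h3⟩ := exists_process o hT hi (h.1.trans T.maxLive_le_ω)
      obtain ⟨p, hp, hp', hp''⟩ := ih (i + 1) _ (by omega) (by omega) h2
      exact ⟨p, mem_mainLoop_of_mem h h1 hp, hp', h3.ext.trans hp''⟩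
    · exact ⟨(i, T), by rw [mainLoop_eq_some h]; exact Part.mem_some _, hT,
        Extends.refl T hT.ρ_le⟩

/-! ### A complete table proves that the rack is finite -/

/-- Every element of the rack is a generator acted on by a word. The word can be traced through live
rows, and the label of the last row is that element. The row of a generator may be dead, but its
representative has the same label. -/
theorem finite_of_isComplete {T : Table R} (hT : Valid T []) (hext : Extends (init R) T)
    (hc : T.IsComplete) : Finite (PresentedRack R) := by
  have H : ∀ (w : List (Letter g)), ∀ i ∈ T.live, ∀ x : PresentedRack R, T.τ i = some x →
      ∃ j ∈ T.live, T.τ j = some (wordAct x w) := by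
    intro w
    induction w with
    | nil => exact fun i hi x hx => ⟨i, hi, hx⟩
    | cons y w ih =>
      intro i hi x hx
      obtain ⟨j, hj⟩ := Option.isSome_iff_exists.1 (hc i hi y)
      exact ih j (hT.mem_live_right hj) _ (by rw [hT.τ_A hj, hx]; rfl)
  have hfin : (T.τ '' (T.live : Set ℕ)).Finite := T.live.finite_toSet.image _
  have hsub : Set.range (some : PresentedRack R → _) ⊆ T.τ '' (T.live : Set ℕ) := by
    rintro _ ⟨⟨a, u⟩, rfl⟩
    obtain ⟨j, hj, h⟩ := H u.toWord _ (hT.rep_mem_live (Nat.succ_pos _)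
      (le_trans (Nat.succ_le_of_lt a.2) hext.ω_le)) (generator R a)
      (by rw [hT.τ_rep, hext.τ_generator])
    refine ⟨j, hj, ?_⟩
    rw [h, generator, wordAct_mk, FreeGroup.mk_toWord, one_mul]
    rfl
  have := (hfin.subset hsub).to_subtype
  exact Finite.of_injective _ (Set.rangeFactorization_injective.2 (Option.some_injective _))

/-- Values in `Part` are unique, so the returned table is the valid one found by the termination
lemmas. -/
theorem finite_of_completes {o : LoopOrder R} (hR : ∀ r ∈ R, r.u = 1 → r.i = r.j) {M : ℕ}
    (h : Completes o M) : Finite (PresentedRack R) := by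
  obtain ⟨T, hT, hc⟩ := h
  obtain ⟨T₁, h1, h2, h3, -⟩ := exists_mem_scanPrimary o hR
  obtain ⟨p, h4, h5, h6⟩ := exists_mem_mainLoop o M _ 1 T₁ rfl le_rfl h2
  obtain ⟨T₁', h1', hT⟩ := Part.mem_bind_iff.1 hT
  obtain rfl := Part.mem_unique h1 h1'
  obtain ⟨p', h4', hT⟩ := Part.mem_bind_iff.1 hT
  obtain rfl := Part.mem_unique h4 h4'
  obtain ⟨i, T'⟩ := p
  dsimp only at hT h5 h6
  split_ifs at hT
  · cases Part.mem_some_iff.1 hT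
    exact finite_of_isComplete h5 (h3.trans h6) hc
  · cases Part.mem_some_iff.1 hT

/-- If at some point all rows are processed, then the process completes. -/
theorem IsRun.completes {o : LoopOrder R} {U : ℕ → Table R} (hU : IsRun o U)
    (hU₀ : U 0 ∈ scanPrimary o (init R)) {n : ℕ}
    (hn : (U n).maxLive < n + 1) (hmin : ∀ m < n, m + 1 ≤ (U m).maxLive) : Completes o n := by
  refine ⟨U n, ?_, ?_⟩
  -- Induction backwards from the end, with `k` the number of rounds still to run.
  · have H : ∀ k ≤ n, (n + 1, U n) ∈ mainLoop o n (n - k + 1) (U (n - k)) := by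
      intro k
      induction k with
      | zero =>
        intro _
        rw [mainLoop_eq_some (by simp)]
        exact Part.mem_some _
      | succ k ih =>
        intro hk
        have e : n - k = n - (k + 1) + 1 := by omega
        obtain ⟨T₁, h1, h2⟩ := hU.step (n - (k + 1)) (hmin _ (by omega))
        refine mem_mainLoop_of_mem ⟨hmin _ (by omega), by omega⟩ h1 ?_
        rw [← h2, ← e]
        exact ih (by omega)
    have h := H n le_rfl
    rw [Nat.sub_self] at h
    refine Part.mem_bind_iff.2 ⟨U 0, hU₀, Part.mem_bind_iff.2 ⟨_, h, ?_⟩⟩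
    dsimp only
    rw [if_pos hn]
    exact Part.mem_some _
  · intro i hi y
    have hi1 := Table.mem_live.1 hi
    have hi2 := Table.le_maxLive hi
    -- A live row `m + 1` was filled in its own round, and its edges persist between classes. As the
    -- row is still live, they are entries.
    obtain ⟨m, rfl⟩ : ∃ m, i = m + 1 := ⟨i - 1, by omega⟩
    have hm : m + 1 ≤ n := by omega
    have hE := hU.mono hm
    have hl : (U (m + 1)).ρ (m + 1) = m + 1 := hE.alive (hU.valid _).ρ_le hi1.2
    obtain ⟨j, hj⟩ := Option.ne_none_iff_exists'.1
      ((hU.processes m (hmin m (by omega))).filled hl y)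
    have := (classEdge_iff (hU.valid n)).1 (hE.edge hj)
    rw [rep_of_mem_live hi] at this
    rw [this]
    rfl

/-! ### Maps from the presented rack to permutation representations -/

section

variable {X : Type*} (step : X → Letter g → X) (hstep : ∀ a y, step (step a y) y.bar = a)

/-- The permutation of `X` given by a generator. -/
def stepPerm (s : Fin g) : Equiv.Perm X where
  toFun a := step a (s, true)
  invFun a := step a (s, false)
  left_inv a := hstep a (s, true)
  right_inv a := hstep a (s, false)

/-- The right action of the free group on `X` given by the action of the letters. -/
def stepHom : FreeGroup (Fin g) →* (Equiv.Perm X)ᵐᵒᵖ :=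
  FreeGroup.lift fun s => MulOpposite.op (stepPerm step hstep s)

theorem stepHom_mk (w : List (Letter g)) (a : X) :
    (stepHom step hstep (FreeGroup.mk w)).unop a = w.foldl step a := by
  induction w generalizing a with
  | nil => rw [← FreeGroup.one_eq_mk, map_one]; rfl
  | cons y w ih =>
    have h : FreeGroup.mk (y :: w) = FreeGroup.mk [y] * FreeGroup.mk w := by
      rw [FreeGroup.mul_mk]; rfl
    rw [h, map_mul, MulOpposite.unop_mul, Equiv.Perm.mul_apply, ih, List.foldl_cons]
    congr 1
    obtain ⟨s, b⟩ := y
    cases b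
    · have h : FreeGroup.mk [(s, false)] = (FreeGroup.of s)⁻¹ := rfl
      rw [h, map_inv, stepHom, FreeGroup.lift_apply_of]
      rfl
    · have h : FreeGroup.mk [(s, true)] = FreeGroup.of s := rfl
      rw [h, stepHom, FreeGroup.lift_apply_of]
      rfl

theorem stepHom_apply (w : FreeGroup (Fin g)) (a : X) :
    (stepHom step hstep w).unop a = w.toWord.foldl step a := by
  rw [← stepHom_mk step hstep, FreeGroup.mk_toWord]

end

section

variable {X : Type*} (π : FreeGroup (Fin g) →* (Equiv.Perm X)ᵐᵒᵖ) (p : Fin g → X)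

/-- The element of the free group by which `x` acts on the free rack. -/
def FreeRack.toGroup {S : Type*} (x : FreeRack S) : FreeGroup S :=
  x.exponent⁻¹ * FreeGroup.of x.base * x.exponent

/-- Acting by `y` multiplies the exponent by `y.toGroup` and conjugates `x.toGroup` by it, so
neither equality is inductive without the other. For a relation in `R`, they come from the primary
and the secondary relation, respectively. -/
theorem Congruent.map_eq (h₁ : ∀ r ∈ R, (π r.u).unop (p r.i) = p r.j)
    (h₂ : ∀ w ∈ secondaryRelations R, π w = 1) {x y : FreeRack (Fin g)} (h : Congruent R x y) :
    (π x.exponent).unop (p x.base) = (π y.exponent).unop (p y.base) ∧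
      π x.toGroup = π y.toGroup := by
  induction h with
  | rel r hr =>
    refine ⟨by rw [map_one]; exact h₁ r hr, ?_⟩
    have := h₂ _ (Finset.mem_image_of_mem _ hr)
    rw [map_mul, map_inv, mul_inv_eq_one] at this
    simpa [FreeRack.toGroup] using this
  | refl x => exact ⟨rfl, rfl⟩
  | symm _ ih => exact ⟨ih.1.symm, ih.2.symm⟩
  | trans _ _ ih ih' => exact ⟨ih.1.trans ih'.1, ih.2.trans ih'.2⟩
  | @act x x' y y' _ _ ihx ihy =>
    have e : ∀ x y : FreeRack (Fin g),
        (Shelf.act y x).exponent = x.exponent * y.toGroup ∧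
        (Shelf.act y x).toGroup = y.toGroup⁻¹ * x.toGroup * y.toGroup := by
      intro x y
      have h : Shelf.act y x =
        ⟨x.base, x.exponent * y.exponent⁻¹ * FreeGroup.of y.base * y.exponent⟩ := rfl
      rw [h]
      constructor <;> simp only [FreeRack.toGroup] <;> group
    refine ⟨?_, ?_⟩
    · rw [(e x y).1, (e x' y').1, map_mul, map_mul, ihy.2, MulOpposite.unop_mul,
        MulOpposite.unop_mul, Equiv.Perm.mul_apply, Equiv.Perm.mul_apply]
      exact congrArg _ ihx.1
    · rw [(e x y).2, (e x' y').2]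
      simp only [map_mul, map_inv, ihx.2, ihy.2]
  | @invAct x x' y y' _ _ ihx ihy =>
    have e : ∀ x y : FreeRack (Fin g),
        (Rack.invAct y x).exponent = x.exponent * y.toGroup⁻¹ ∧
        (Rack.invAct y x).toGroup = y.toGroup * x.toGroup * y.toGroup⁻¹ := by
      intro x y
      have h : Rack.invAct y x =
        ⟨x.base, x.exponent * y.exponent⁻¹ * (FreeGroup.of y.base)⁻¹ * y.exponent⟩ := rfl
      rw [h]
      constructor <;> simp only [FreeRack.toGroup] <;> group
    refine ⟨?_, ?_⟩
    · rw [(e x y).1, (e x' y').1, map_mul, map_mul, map_inv, map_inv, ihy.2, MulOpposite.unop_mul,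
        MulOpposite.unop_mul, Equiv.Perm.mul_apply, Equiv.Perm.mul_apply]
      exact congrArg _ ihx.1
    · rw [(e x y).2, (e x' y').2]
      simp only [map_mul, map_inv, ihx.2, ihy.2]

/-- If `⟨x_1, …, x_g | R⟩` is finite and its relations hold in a right action of the free group on
`X`, then the orbits of the points that represent the generators are finite. -/
theorem finite_of_action [Finite (PresentedRack R)] (h₁ : ∀ r ∈ R, (π r.u).unop (p r.i) = p r.j)
    (h₂ : ∀ w ∈ secondaryRelations R, π w = 1) (h₃ : ∀ a, ∃ s u, (π u).unop (p s) = a) :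
    Finite X := by
  let Φ : PresentedRack R → X :=
    Quotient.lift (fun x => (π x.exponent).unop (p x.base)) fun _ _ h =>
      (Congruent.map_eq π p h₁ h₂ h).1
  refine Finite.of_surjective Φ fun a => ?_
  obtain ⟨s, u, h⟩ := h₃ a
  exact ⟨Quotient.mk (congruence R) ⟨s, u⟩, h⟩

end

/-! ### The limit of a run that does not stop -/

theorem ClassEdge.pos {T : Table R} {Q : List ℕ} (hT : Valid T Q) {a b : ℕ} {y : Letter g}
    (h : ClassEdge T a y b) : 1 ≤ a := by
  obtain ⟨i, j, hij, hi, -⟩ := h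
  have h1 := rep_pos hT.ρ_pos (hT.row hij).1
  rw [hi] at h1
  exact h1.trans (rep_le _ _)

/-- The rows that never die. -/
def Immortal (U : ℕ → Table R) : Type :=
  {a : ℕ // 1 ≤ a ∧ ∀ n, (U n).ρ a = a}

/-- The representative of row `a` is eventually `b`. -/
def LimitRep (U : ℕ → Table R) (a : ℕ) (b : Immortal U) : Prop :=
  ∀ᶠ n in Filter.atTop, rep (U n).ρ a = b.1

section

variable {o : LoopOrder R} {U : ℕ → Table R}

theorem LimitRep.unique {a : ℕ} {b b' : Immortal U} (h : LimitRep U a b) (h' : LimitRep U a b') :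
    b = b' := by
  obtain ⟨n, hn, hn'⟩ := (h.and h').exists
  exact Subtype.ext (hn.symm.trans hn')

theorem LimitRep.refl (a : Immortal U) : LimitRep U a.1 a :=
  Filter.Eventually.of_forall fun n => rep_of_eq (a.2.2 n)

/-- The representative of `a` is nonincreasing in time, hence constant once it is minimal. The row
where it settles is live at all late times, and so at all times. -/
theorem IsRun.exists_limitRep (hU : IsRun o U) {a : ℕ} (ha : 1 ≤ a) : ∃ b, LimitRep U a b := by
  obtain ⟨n, hn⟩ : ∃ n, ∀ m, rep (U n).ρ a ≤ rep (U m).ρ a :=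
    ⟨Function.argmin fun n => rep (U n).ρ a, fun m => Function.argmin_le (fun n => rep (U n).ρ a) m⟩
  have hm : ∀ m ≥ n, rep (U m).ρ a = rep (U n).ρ a := fun m hm =>
    le_antisymm (by rw [← (hU.mono hm).rep_rep]; exact rep_le _ _) (hn m)
  have hfix : ∀ m ≥ n, (U m).ρ (rep (U n).ρ a) = rep (U n).ρ a := fun m h => by
    rw [← hm m h, map_rep (hU.valid m).ρ_le]
  refine ⟨⟨rep (U n).ρ a, rep_pos (hU.valid n).ρ_pos ha, fun k => ?_⟩,
    Filter.eventually_atTop.2 ⟨n, hm⟩⟩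
  exact (hU.mono (le_max_left k n)).alive (hU.valid k).ρ_le (hfix _ (le_max_right k n))

theorem IsRun.eventually_entry (hU : IsRun o U) {n a b : ℕ} {y : Letter g}
    (h : ClassEdge (U n) a y b) {a' b' : Immortal U} (ha : LimitRep U a a')
    (hb : LimitRep U b b') : ∀ᶠ m in Filter.atTop, (U m).A a'.1 y = some b'.1 := by
  filter_upwards [ha, hb, Filter.eventually_ge_atTop n] with m hma hmb hm
  rw [← hma, ← hmb]
  exact (classEdge_iff (hU.valid m)).1 ((hU.mono hm).classEdge h)

/-- Row `a` is filled in round `a`, and the representatives of the targets settle. -/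
theorem IsRun.exists_entry (hU : IsRun o U) (hinf : ∀ n, n + 1 ≤ (U n).maxLive) (a : Immortal U)
    (y : Letter g) : ∃ b : Immortal U, ∀ᶠ n in Filter.atTop, (U n).A a.1 y = some b.1 := by
  obtain ⟨m, hm⟩ : ∃ m, a.1 = m + 1 := ⟨a.1 - 1, by have := a.2.1; omega⟩
  obtain ⟨j, hj⟩ := Option.ne_none_iff_exists'.1
    ((hU.processes m (hinf m)).filled (hm ▸ a.2.2 _) y)
  rw [← hm] at hj
  obtain ⟨b, hb⟩ := hU.exists_limitRep ((hU.valid _).row_right hj).1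
  exact ⟨b, hU.eventually_entry (ClassEdge.of_entry hj) (LimitRep.refl a) hb⟩

/-- A class edge at one time becomes an entry between limit rows. At a common late time it is
compared with the entry that defines `step`. -/
theorem IsRun.foldl_eq (hU : IsRun o U) {step : Immortal U → Letter g → Immortal U}
    (hstep : ∀ a y, ∀ᶠ n in Filter.atTop, (U n).A a.1 y = some (step a y).1) {n a b : ℕ}
    {w : List (Letter g)} (h : ClassPath (U n) a w b) {a' b' : Immortal U} (ha : LimitRep U a a')
    (hb : LimitRep U b b') : w.foldl step a' = b' := by
  induction w generalizing a a' with
  | nil =>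
    refine ha.unique ?_
    filter_upwards [hb, Filter.eventually_ge_atTop n] with m hm hnm
    rw [← hm]
    exact (hU.mono hnm).rep_eq h
  | cons y w ih =>
    obtain ⟨c, hc, h⟩ := h
    obtain ⟨c', hc'⟩ := hU.exists_limitRep ((hc.symm (hU.valid n)).pos (hU.valid n))
    obtain ⟨m, hm, hm'⟩ := ((hU.eventually_entry hc ha hc').and (hstep a' y)).exists
    rw [hm] at hm'
    have : step a' y = c' := Subtype.ext (Option.some_injective _ hm').symm
    rw [List.foldl_cons, this]
    exact ih h hc'

/-- If the rack is finite, then a run stops. -/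
theorem IsRun.exists_maxLive_lt [Finite (PresentedRack R)] (hU : IsRun o U)
    (hinit : Extends (init R) (U 0))
    (hprim : ∀ r ∈ R, ClassPath (U 0) (r.i + 1) r.u.toWord (r.j + 1)) :
    ∃ n, (U n).maxLive < n + 1 := by
  by_contra! hinf
  choose step hstep using hU.exists_entry hinf
  choose p hp using fun s : Fin g => hU.exists_limitRep (Nat.succ_pos s)
  have hbar : ∀ a y, step (step a y) y.bar = a := by
    intro a y
    obtain ⟨m, hm, hm'⟩ := ((hstep a y).and (hstep (step a y) y.bar)).exists
    rw [(hU.valid m).symm hm] at hm'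
    exact (Subtype.ext (Option.some_injective _ hm')).symm
  have hreach : ∀ n j, g < j → j ≤ (U n).ω → ∃ i y, i < j ∧ 1 ≤ i ∧ ClassEdge (U n) i y j := by
    intro n j hj hj'
    obtain ⟨i, y, hij, h⟩ := (hinit.trans (hU.mono n.zero_le)).reach j hj hj'
    exact ⟨i, y, hij, h.pos (hU.valid n), h⟩
  have horbit : ∀ j, 1 ≤ j → ∃ s u, LimitRep U j ((stepHom step hbar u).unop (p s)) := by
    intro j
    induction j using Nat.strong_induction_on with
    | _ j ih =>
      intro hj
      by_cases hjg : j ≤ g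
      · obtain ⟨s, rfl⟩ : ∃ s : Fin g, j = s + 1 := ⟨⟨j - 1, by omega⟩, by simp; omega⟩
        exact ⟨s, 1, by rw [map_one]; exact hp s⟩
      -- Time `j` is late enough for row `j` to exist, since `j + 1 ≤ max Ω` there. In particular,
      -- no immortal row is a mere index beyond the table.
      · obtain ⟨i, y, hij, hi, h⟩ := hreach j j (by omega)
          ((Nat.le_succ j).trans ((hinf j).trans (U j).maxLive_le_ω))
        obtain ⟨s, u, hsu⟩ := ih i hij hi
        obtain ⟨b, hb⟩ := hU.exists_limitRep hj
        refine ⟨s, u * FreeGroup.mk [y], ?_⟩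
        rw [map_mul, MulOpposite.unop_mul, Equiv.Perm.mul_apply, stepHom_mk,
          hU.foldl_eq hstep (w := [y]) ⟨j, h, rfl⟩ hsu hb]
        exact hb
  have hfin : Finite (Immortal U) := by
    refine finite_of_action (R := R) (stepHom step hbar) p ?_ ?_ ?_
    · intro r hr
      rw [stepHom_apply]
      exact hU.foldl_eq hstep (hprim r hr) (hp r.i) (hp r.j)
    · intro w hw
      refine MulOpposite.unop_injective (Equiv.ext fun a => ?_)
      rw [stepHom_apply]
      obtain ⟨m, hm⟩ : ∃ m, a.1 = m + 1 := ⟨a.1 - 1, by have := a.2.1; omega⟩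
      have h := (hU.processes m (hinf m)).path (hm ▸ a.2.2 _) w hw
      rw [← hm] at h
      exact hU.foldl_eq hstep h (LimitRep.refl a) (LimitRep.refl a)
    · intro a
      obtain ⟨s, u, h⟩ := horbit a.1 a.2.1
      exact ⟨s, u, h.unique (LimitRep.refl a)⟩
  obtain ⟨N, hN⟩ := (Set.finite_range fun a : Immortal U => a.1).bddAbove
  -- As immortal rows, letters and generators are finite in number, one time `n ≥ N` has all entries
  -- of immortal rows and all representatives of generators final.
  obtain ⟨n, hn, hn', hNn⟩ := ((Filter.eventually_all.2 fun a => Filter.eventually_all.2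
    (hstep a)).and ((Filter.eventually_all.2 hp).and (Filter.eventually_ge_atTop N))).exists
  -- At this time every representative is immortal already: generators have settled, and an edge
  -- from an immortal row leads to an immortal row.
  have hrows : ∀ j, 1 ≤ j → j ≤ (U n).ω → ∃ a : Immortal U, rep (U n).ρ j = a.1 := by
    intro j
    induction j using Nat.strong_induction_on with
    | _ j ih =>
      intro hj hj'
      by_cases hjg : j ≤ g
      · obtain ⟨s, rfl⟩ : ∃ s : Fin g, j = s + 1 := ⟨⟨j - 1, by omega⟩, by simp; omega⟩
        exact ⟨p s, hn' s⟩
      · obtain ⟨i, y, hij, hi, h⟩ := hreach n j (by omega) hj'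
        obtain ⟨a, ha⟩ := ih i hij hi (hij.le.trans hj')
        have h' := (classEdge_iff (hU.valid n)).1 h
        rw [ha, hn a y] at h'
        exact ⟨step a y, (Option.some_injective _ h').symm⟩
  have hmax : (U n).maxLive ≤ N := Table.maxLive_le fun i hi => by
    have hi' := (Table.mem_live.1 hi).1
    obtain ⟨a, ha⟩ := hrows i hi'.1 hi'.2
    rw [rep_of_mem_live hi] at ha
    exact ha ▸ hN ⟨a, rfl⟩
  have := hinf n
  omega

end

end RackEnum

theorem mainTheorem3 {g : ℕ} (R : Finset (RackEnum.Relation g))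
    (hR : ∀ r ∈ R, r.u = 1 → r.i = r.j) (o : RackEnum.LoopOrder R) :
    Finite (RackEnum.PresentedRack R) ↔ ∃ M : ℕ, RackEnum.Completes o M := by
  refine ⟨fun _ => ?_, fun ⟨_, h⟩ => RackEnum.finite_of_completes hR h⟩
  obtain ⟨T, hT, hv, hext, hprim⟩ := RackEnum.exists_mem_scanPrimary o hR
  obtain ⟨U, rfl, hU⟩ := RackEnum.exists_isRun o hv
  classical
  have h := hU.exists_maxLive_lt hext hprim
  exact ⟨Nat.find h, hU.completes hT (Nat.find_spec h) fun m hm => not_lt.1 (Nat.find_min h hm)⟩
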